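/- **Setting.** There are $n$ bidders and $m$ types of goods, with $k_j$ units of good $j$. Bidder $i$ has a monotone valuation $v_i:\mathbb N^m\to[0,H]$ with $v_i(x)=v_i(\min\{x^1,r\},\dots,\min\{x^m,r\})$ for all $x$ ($r\ge 1$) and $v_i(x)\ge\rho>0$ for every $x\ne 0$. For each good $j$ bidder $i$ submits marginal bids $b_i^{j,1}\ge\dots\ge b_i^{j,r}$ in $[0,B)$, where $B\ge H$. Each bidder independently fails to arrive with probability $\delta\in(0,1)$; the bids of a bidder who does not arrive are replaced by $0$. Then each good is sold in a separate uniform price auction: the $k_j$ highest bids win one unit each, ties are broken by processing the bidders in a uniformly random order (independent across goods; the tied bids of one bidder are processed consecutively), and each unit is sold at the highest losing bid (the $(k_j+1)$-th highest bid, or $0$ if no bid loses). For a bid profile $s$, let $u_i(s)$ be the expected value minus payment of bidder $i$, counted as $0$ when she does not arrive, let $\mathcal R(s)$ be the expected revenue, let $SW(s)$ be the expected total value of the arriving bidders, and let $\mathrm{Opt}(v)$ be the expected (over arrivals) maximum total value of the arriving bidders over allocations with $\sum_i x_i^j\le k_j$. The auction is $(\lambda,\mu)$-smooth if for every valuation profile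 $v$ there are randomized strategies $s_i^*$, $i=1,\dots,n$, such that for every bid profile $s$ $$\sum_{i=1}^n u_i(s_i^*,s_{-i})\ \ge\ \lambda\,\mathrm{Opt}(v)-\mu\,\mathcal R(s).$$ Its robust price of anarchy is the infimum of $\max\{1,\mu\}/\lambda$ over all $\lambda>0$, $\mu\ge0$ for which it is $(\lambda,\mu)$-smooth. **Theorem.** (a) Let $\varepsilon>0$ and suppose that for every good $j$ $$k_j\ \ge\ \frac{16\,m^2(B+H)^2r^8}{\varepsilon^2\rho^2\,\delta(1-\delta)}+r .$$ Then the auction is $(1-\varepsilon,1)$-smooth, i.e. for every $v$ there are $s_i^*$ with $\sum_i u_i(s_i^*,s_{-i})\ge(1-\varepsilon)\mathrm{Opt}(v)-\mathcal R(s)$ for every $s$. Hence, if $\varepsilon<1$, the robust price of anarchy is at most $\frac1{1-\varepsilon}$. Moreover, at every coarse correlated equilibrium (CCE, for any fixed valuation profile) and at every Bayes–Nash equilibrium (BNE, for any independent distributions of the valuations) the expected welfare is at least $(1-\varepsilon)$ times the expected optimal welfare. (b) If $r=1$, the conclusions of (a) already hold when $k_j\ge\dfrac{36\,m^2(B+H)^2}{\varepsilon^2\rho^2\,\delta(1-\delta)}$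 for every $j$. (c) For every $c>0$ there is a constant $C$, depending only on $c,m,r,\rho,B,H,\delta$, such that whenever $n\ge1$ and $k_j\ge c\,n$ for every $j$, the expected welfare at every BNE and every CCE is at least $\left(1-\frac{C}{\sqrt n}\right)$ times the expected optimal welfare. -/

import Mathlib

open MeasureTheory ProbabilityTheory
open scoped ENNReal

noncomputable section

namespace UniformPrice

/-! ### Valuations and optimal welfare -/

/-- Set functions on bundles: `x j` is the number of units of good `j`. -/
abbrev Val (m : ℕ) := (Fin m → ℕ) → ℝ

/-- Admissible valuations: monotone, with values in `[0, H]`, demanding at most `r` units of each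
good, and worth at least `ρ` on every non-zero bundle. -/
def valuations (m r : ℕ) (H ρ : ℝ) : Set (Val m) :=
  {v | Monotone v ∧ (∀ x, 0 ≤ v x ∧ v x ≤ H) ∧ (∀ x, v x = v (fun j => min (x j) r)) ∧
    ∀ x, x ≠ 0 → ρ ≤ v x}

/-- The maximum of `∑ i, v i (x i)` over allocations `x` that respect the supply `k`. -/
def optWelfare {n m : ℕ} (k : Fin m → ℕ) (v : Fin n → Val m) : ℝ :=
  sSup {w | ∃ x : Fin n → Fin m → ℕ, (∀ j, ∑ i, x i j ≤ k j) ∧ w = ∑ i, v i (x i)}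

/-! ### One uniform price auction -/

/-- `a i t` is the `t`-th marginal bid of bidder `i` and `σ` the priority order of the bidders.
`Beats a σ p q`: bid `p` is processed before bid `q`. Higher bids come first; among equal bids the
bidders are processed in the order `σ`, the bids of one bidder consecutively. -/
def Beats {n r : ℕ} (a : Fin n → Fin r → ℝ) (σ : Equiv.Perm (Fin n)) (p q : Fin n × Fin r) :
    Prop :=
  a q.1 q.2 < a p.1 p.2 ∨
    (a p.1 p.2 = a q.1 q.2 ∧ (σ p.1 < σ q.1 ∨ (p.1 = q.1 ∧ p.2 < q.2)))

/-- With `K` units for sale, the first `K` bids win. -/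
def Wins {n r : ℕ} (K : ℕ) (a : Fin n → Fin r → ℝ) (σ : Equiv.Perm (Fin n))
    (p : Fin n × Fin r) : Prop :=
  Set.ncard {q | Beats a σ q p} < K

open Classical in
/-- The highest losing marginal bid, i.e. the `(K + 1)`-th highest bid (`0` if no bid loses). -/
def price {n r : ℕ} (K : ℕ) (a : Fin n → Fin r → ℝ) (σ : Equiv.Perm (Fin n)) : ℝ :=
  ⨆ p : Fin n × Fin r, if Wins K a σ p then 0 else a p.1 p.2

/-! ### The simultaneous auctions without noise

`b i j t` is the `t`-th marginal bid of bidder `i` for good `j`; `σ j` is the priority order used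
for good `j`. -/

/-- The bundle won by bidder `i`. -/
def bundle {n m r : ℕ} (k : Fin m → ℕ) (b : Fin n → Fin m → Fin r → ℝ)
    (σ : Fin m → Equiv.Perm (Fin n)) (i : Fin n) : Fin m → ℕ :=
  fun j => Set.ncard {t : Fin r | Wins (k j) (fun l => b l j) (σ j) (i, t)}

/-- The total payment of bidder `i`. -/
def payment {n m r : ℕ} (k : Fin m → ℕ) (b : Fin n → Fin m → Fin r → ℝ)
    (σ : Fin m → Equiv.Perm (Fin n)) (i : Fin n) : ℝ :=
  ∑ j, (bundle k b σ i j : ℝ) * price (k j) (fun l => b l j) (σ j)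

/-- Expectation over tie-breaking: independent uniform priority orders, one for each good. -/
def tieExp {n m : ℕ} (f : (Fin m → Equiv.Perm (Fin n)) → ℝ) : ℝ :=
  (∑ σ, f σ) / (Fintype.card (Fin m → Equiv.Perm (Fin n)) : ℝ)

/-! ### Noisy arrival -/

/-- Expectation over arrivals: each bidder independently fails to arrive with probability `δ`. -/
def arrivalExp {n : ℕ} (δ : ℝ) (f : (Fin n → Bool) → ℝ) : ℝ :=
  ∑ z : Fin n → Bool, (∏ i, if z i then 1 - δ else δ) * f z

/-- A pure strategy: for each good, `r` non-increasing marginal bids in `[0, B)`. -/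
def bidSet (m r : ℕ) (B : ℝ) : Set (Fin m → Fin r → ℝ) :=
  {b | ∀ j, Antitone (b j) ∧ ∀ t, 0 ≤ b j t ∧ b j t < B}

/-- The space of pure strategies. -/
abbrev Bid (m r : ℕ) (B : ℝ) := ↥(bidSet m r B)

/-- The bid profile `s · z`: bids of bidders who did not arrive are replaced by zero. -/
def arriving {n m r : ℕ} {B : ℝ} (s : Fin n → Bid m r B) (z : Fin n → Bool) :
    Fin n → Fin m → Fin r → ℝ :=
  fun i j t => if z i then (s i).1 j t else 0

/-- Expected utility of bidder `i` with valuation `w` at the profile `s`, with noisy arrival. -/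
def utility {n m r : ℕ} {B : ℝ} (k : Fin m → ℕ) (δ : ℝ) (s : Fin n → Bid m r B) (i : Fin n)
    (w : Val m) : ℝ :=
  arrivalExp δ fun z => if z i then
    tieExp fun σ => w (bundle k (arriving s z) σ i) - payment k (arriving s z) σ i else 0

/-- Expected revenue, with noisy arrival. -/
def revenue {n m r : ℕ} {B : ℝ} (k : Fin m → ℕ) (δ : ℝ) (s : Fin n → Bid m r B) : ℝ :=
  arrivalExp δ fun z => tieExp fun σ => ∑ i, payment k (arriving s z) σ i

/-- Expected social welfare, with noisy arrival. -/
def welfare {n m r : ℕ} {B : ℝ} (k : Fin m → ℕ) (δ : ℝ) (s : Fin n → Bid m r B)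
    (v : Fin n → Val m) : ℝ :=
  arrivalExp δ fun z => tieExp fun σ =>
    ∑ i, if z i then v i (bundle k (arriving s z) σ i) else 0

/-- Expected optimal welfare of the arriving bidders. -/
def expOpt {n m : ℕ} (k : Fin m → ℕ) (δ : ℝ) (v : Fin n → Val m) : ℝ :=
  arrivalExp δ fun z => optWelfare k fun i x => if z i then v i x else 0

/-! ### Smoothness -/

/-- The noisy-arrival auction is a `(lam, mu)`-smooth mechanism: for every valuation profile `v`
there are (possibly randomized) deviations `τ i`, chosen independently of `s`, with
`∑ i, u i (τ i, s₋ᵢ) ≥ lam * Opt v - mu * R s` at every profile `s`. -/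
def IsSmooth (n : ℕ) {m : ℕ} (r : ℕ) (k : Fin m → ℕ) (H B ρ δ lam mu : ℝ) : Prop :=
  ∀ v : Fin n → Val m, (∀ i, v i ∈ valuations m r H ρ) →
    ∃ τ : Fin n → Measure (Bid m r B), (∀ i, IsProbabilityMeasure (τ i)) ∧
      ∀ s : Fin n → Bid m r B,
        lam * expOpt k δ v - mu * revenue k δ s ≤
          ∑ i, ∫ t, utility k δ (Function.update s i t) i (v i) ∂(τ i)

/-- The robust price of anarchy: the best bound `max {1, mu} / lam` over all `lam > 0`, `mu ≥ 0`
for which the mechanism is `(lam, mu)`-smooth. -/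
def robustPoA (n : ℕ) {m : ℕ} (r : ℕ) (k : Fin m → ℕ) (H B ρ δ : ℝ) : ℝ≥0∞ :=
  sInf {q | ∃ lam mu : ℝ, 0 < lam ∧ 0 ≤ mu ∧ IsSmooth n r k H B ρ δ lam mu ∧
    q = ENNReal.ofReal (max 1 mu / lam)}

/-! ### Equilibria -/

/-- Coarse correlated equilibrium: `D` is the joint law of the bids, `v` the valuation profile. -/
def IsCCE {n m r : ℕ} {B : ℝ} (k : Fin m → ℕ) (δ : ℝ) (v : Fin n → Val m)
    (D : Measure (Fin n → Bid m r B)) : Prop :=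
  ∀ (i : Fin n) (t : Bid m r B),
    ∫ s, utility k δ (Function.update s i t) i (v i) ∂D ≤ ∫ s, utility k δ s i (v i) ∂D

/-- Joint law of the valuations and bids, when the valuations are drawn independently from the
`F i` and bidder `i` with valuation `w` draws her bids from `β i w`. -/
def playLaw {n m r : ℕ} {B : ℝ} (F : Fin n → Measure (Val m))
    (β : Fin n → Kernel (Val m) (Bid m r B)) : Measure (Fin n → Val m × Bid m r B) :=
  Measure.pi fun i => F i ⊗ₘ β i

/-- Bayes-Nash equilibrium: for every bidder `i` and (almost) every valuation `w` of hers, no bid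
`t` gives a higher expected utility against the others' bids than her own (randomized) strategy. -/
def IsBNE {n m r : ℕ} {B : ℝ} (k : Fin m → ℕ) (δ : ℝ) (F : Fin n → Measure (Val m))
    (β : Fin n → Kernel (Val m) (Bid m r B)) : Prop :=
  ∀ i : Fin n, ∀ᵐ w ∂(F i), ∀ t : Bid m r B,
    ∫ p, utility k δ (Function.update (fun l => (p l).2) i t) i w ∂(playLaw F β) ≤
      ∫ t', ∫ p, utility k δ (Function.update (fun l => (p l).2) i t') i w ∂(playLaw F β)
        ∂(β i w)

/-- At every coarse correlated equilibrium (for every admissible valuation profile) and at every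
Bayes-Nash equilibrium (for all independent distributions of admissible valuations), the expected
welfare is at least `α` times the expected optimal welfare. -/
def EquilibriaAchieve (n : ℕ) {m : ℕ} (r : ℕ) (k : Fin m → ℕ) (H B ρ δ α : ℝ) : Prop :=
  (∀ v : Fin n → Val m, (∀ i, v i ∈ valuations m r H ρ) →
    ∀ D : Measure (Fin n → Bid m r B), IsProbabilityMeasure D → IsCCE k δ v D →
      α * expOpt k δ v ≤ ∫ s, welfare k δ s v ∂D) ∧
  (∀ F : Fin n → Measure (Val m), (∀ i, IsProbabilityMeasure (F i)) →
    (∀ i, ∀ᵐ w ∂(F i), w ∈ valuations m r H ρ) →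
    ∀ β : Fin n → Kernel (Val m) (Bid m r B), (∀ i, IsMarkovKernel (β i)) → IsBNE k δ F β →
      α * ∫ v, expOpt k δ v ∂(Measure.pi F) ≤
        ∫ p, welfare k δ (fun i => (p i).2) (fun i => (p i).1) ∂(playLaw F β))

end UniformPrice

end

/-!
Every bidder has a deviation that makes her nearly a price taker. She samples arrivals `z` of all
bidders, computes an optimal allocation for `z` with herself present, and bids almost `H` on the
units of her bundle and `0` on the rest. Pointwise this earns almost the value of the bundle minus
its cost at the realized prices: either the bundle is won, or some good in it has a price that is
almost the value of the whole bundle or more (`value_sub_payment_flatBid_ge`). If the deviation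
did not move the prices, summing over the bidders would give the expected optimal welfare minus
the cost of an optimal allocation at the prices of the original profile, which is at most the
revenue since a uniform price auction with a positive price sells all units
(`sum_mul_noisyPrice_le_revenue`).

Noise bounds the price impact. A bidder with at most `r` bids keeps the price between the
`(K + 1)`-th and the `(K + 1 - r)`-th highest arriving bid of the others, so it suffices to bound
`E[π_T - π_{T+1}]` for `K - r ≤ T < K`, with `π_T` the price for `T` units
(`arrivalExp_noisyPrice_sub_succ_le`). Consider the `N ≥ (T + 1) / r` bidders with the highest
first bids (with fewer bidders both prices vanish): the presence of each of them raises
`h = π_T + π_{T+1}` by at least `π_T - π_{T+1}`, whatever the other arrivals are. The sum of these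
discrete derivatives, times `δ (1 - δ)`, is in expectation the covariance of `h` with the number
of these bidders who arrive, at most `B √(N δ (1 - δ))`. Hence
`E[π_T - π_{T+1}] ≤ B / √(N δ (1 - δ))`, with no local limit theorem. As a non-zero bundle is
worth at least `ρ`, the total loss is an `ε`-fraction of the optimal welfare (`exists_deviation`).

The deviations do not depend on the bids of the others, which yields smoothness and the welfare
bound at coarse correlated equilibria by averaging. At a Bayes-Nash equilibrium the inequality is
averaged over the bids for almost every fixed valuation profile and then over the profiles;
resampling the valuation and bid of one bidder preserves the joint law
(`measurePreserving_update`), so the interim payoffs integrate to the expected utilities. The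
deviations need not depend measurably on the valuations.
-/

namespace UniformPrice

/-! ### Expectation over arrivals and over tie-breaking -/

section Arrival

variable {n : ℕ} {δ : ℝ}

lemma arrivalExp_add (f g : (Fin n → Bool) → ℝ) :
    arrivalExp δ (fun z => f z + g z) = arrivalExp δ f + arrivalExp δ g := by
  simp [arrivalExp, mul_add, Finset.sum_add_distrib]

lemma arrivalExp_sub (f g : (Fin n → Bool) → ℝ) :
    arrivalExp δ (fun z => f z - g z) = arrivalExp δ f - arrivalExp δ g := by
  simp [arrivalExp, mul_sub, Finset.sum_sub_distrib]

lemma arrivalExp_const_mul (c : ℝ) (f : (Fin n → Bool) → ℝ) :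
    arrivalExp δ (fun z => c * f z) = c * arrivalExp δ f := by
  simp only [arrivalExp, Finset.mul_sum]
  exact Finset.sum_congr rfl fun z _ => by ring

lemma arrivalExp_sum {ι : Type*} (s : Finset ι) (f : ι → (Fin n → Bool) → ℝ) :
    arrivalExp δ (fun z => ∑ i ∈ s, f i z) = ∑ i ∈ s, arrivalExp δ (f i) := by
  simp only [arrivalExp, Finset.mul_sum]
  exact Finset.sum_comm

lemma arrivalExp_const (c : ℝ) : arrivalExp δ (fun _ : Fin n → Bool => c) = c := by
  have h : ∑ z : Fin n → Bool, ∏ i, (if z i then 1 - δ else δ) = 1 := by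
    have := Finset.prod_univ_sum (fun _ : Fin n => (Finset.univ : Finset Bool))
      (fun _ b => if b then 1 - δ else δ)
    rw [Fintype.piFinset_univ] at this
    rw [← this]
    simp
  rw [arrivalExp, ← Finset.sum_mul, h, one_mul]

lemma arrivalWeight_nonneg (h0 : 0 ≤ δ) (h1 : δ ≤ 1) (z : Fin n → Bool) :
    0 ≤ ∏ i, (if z i then 1 - δ else δ) :=
  Finset.prod_nonneg fun i _ => by split_ifs <;> linarith

lemma arrivalExp_mono (h0 : 0 ≤ δ) (h1 : δ ≤ 1) {f g : (Fin n → Bool) → ℝ}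
    (h : ∀ z, f z ≤ g z) : arrivalExp δ f ≤ arrivalExp δ g :=
  Finset.sum_le_sum fun z _ => mul_le_mul_of_nonneg_left (h z) (arrivalWeight_nonneg h0 h1 z)

lemma arrivalExp_nonneg (h0 : 0 ≤ δ) (h1 : δ ≤ 1) {f : (Fin n → Bool) → ℝ}
    (h : ∀ z, 0 ≤ f z) : 0 ≤ arrivalExp δ f :=
  Finset.sum_nonneg fun z _ => mul_nonneg (arrivalWeight_nonneg h0 h1 z) (h z)

lemma abs_arrivalExp_le (h0 : 0 ≤ δ) (h1 : δ ≤ 1) {f : (Fin n → Bool) → ℝ} {C : ℝ}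
    (h : ∀ z, |f z| ≤ C) : |arrivalExp δ f| ≤ C := by
  rw [abs_le]
  constructor
  · calc -C = arrivalExp δ (fun _ : Fin n → Bool => -C) := (arrivalExp_const _).symm
      _ ≤ _ := arrivalExp_mono h0 h1 fun z => (abs_le.1 (h z)).1
  · calc _ ≤ arrivalExp δ (fun _ : Fin n → Bool => C) :=
        arrivalExp_mono h0 h1 fun z => (abs_le.1 (h z)).2
      _ = C := arrivalExp_const _

/-- Conditioning on the arrival of one bidder `l`. -/
lemma arrivalExp_eq_update (l : Fin n) (f : (Fin n → Bool) → ℝ) :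
    arrivalExp δ f = (1 - δ) * arrivalExp δ (fun z => f (Function.update z l true)) +
      δ * arrivalExp δ (fun z => f (Function.update z l false)) := by
  classical
  let e := Equiv.funSplitAt l Bool
  have hupd : ∀ (c d : Bool) y, Function.update (e.symm (d, y)) l c = e.symm (c, y) := by
    intro c d y
    ext j
    by_cases hj : j = l
    · subst hj; simp [e]
    · simp [e, hj]
  have key : ∀ g : (Fin n → Bool) → ℝ, arrivalExp δ g =
      ∑ c : Bool, ∑ y : {j // j ≠ l} → Bool,
        ((if c then 1 - δ else δ) * ∏ j, if y j then 1 - δ else δ) * g (e.symm (c, y)) := by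
    intro g
    rw [arrivalExp, ← Equiv.sum_comp e.symm, Fintype.sum_prod_type]
    refine Finset.sum_congr rfl fun c _ => Finset.sum_congr rfl fun y _ => ?_
    congr 1
    rw [Fintype.prod_eq_mul_prod_subtype_ne _ l]
    congr 1
    · simp [e]
    · refine Finset.prod_congr rfl fun j _ => ?_
      simp [e, j.2]
  simp only [key, hupd, Fintype.sum_bool, if_true, Bool.false_eq_true, if_false]
  simp only [mul_assoc, ← Finset.mul_sum]
  ring

/-- Averaging over a value that does not depend on whether `l` arrives. -/
lemma arrivalExp_ite_update (l : Fin n) (f : (Fin n → Bool) → ℝ) :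
    arrivalExp δ (fun z => if z l then f z else 0) =
      (1 - δ) * arrivalExp δ (fun z => f (Function.update z l true)) := by
  rw [arrivalExp_eq_update l]
  simp [arrivalExp_const]

/-- The discrete derivative formula `E[(zₗ - p) f] = p (1 - p) E[Dₗ f]` with `p = 1 - δ`. -/
lemma arrivalExp_centered_mul (l : Fin n) (f : (Fin n → Bool) → ℝ) :
    arrivalExp δ (fun z => ((if z l then 1 else 0) - (1 - δ)) * f z) =
      δ * (1 - δ) * arrivalExp δ (fun z => f (Function.update z l true) -
        f (Function.update z l false)) := by
  rw [arrivalExp_eq_update l]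
  simp only [Function.update_self, if_true, Bool.false_eq_true, if_false, arrivalExp_const_mul,
    arrivalExp_sub]
  ring

lemma arrivalExp_centered_sq (A : Finset (Fin n)) :
    arrivalExp δ (fun z => (∑ l ∈ A, (((if z l then 1 else 0) : ℝ) - (1 - δ))) ^ 2) =
      A.card * (δ * (1 - δ)) := by
  have h1 : ∀ z : Fin n → Bool, (∑ l ∈ A, (((if z l then 1 else 0) : ℝ) - (1 - δ))) ^ 2 =
      ∑ l ∈ A, (((if z l then 1 else 0) : ℝ) - (1 - δ)) *
        ∑ l' ∈ A, (((if z l' then 1 else 0) : ℝ) - (1 - δ)) := by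
    intro z
    rw [sq, Finset.sum_mul]
  simp only [h1, arrivalExp_sum, arrivalExp_centered_mul]
  have h2 : ∀ l ∈ A, ∀ z : Fin n → Bool,
      (∑ l' ∈ A, (((if Function.update z l true l' then 1 else 0) : ℝ) - (1 - δ))) -
      (∑ l' ∈ A, (((if Function.update z l false l' then 1 else 0) : ℝ) - (1 - δ))) = 1 := by
    intro l hl z
    rw [← Finset.sum_sub_distrib, Finset.sum_eq_single_of_mem l hl]
    · simp
    · intro l' _ hne
      simp [hne]
  have h3 : ∀ l ∈ A, δ * (1 - δ) * arrivalExp δ (fun z : Fin n → Bool =>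
      (∑ l' ∈ A, (((if Function.update z l true l' then 1 else 0) : ℝ) - (1 - δ))) -
      (∑ l' ∈ A, (((if Function.update z l false l' then 1 else 0) : ℝ) - (1 - δ)))) =
      δ * (1 - δ) := by
    intro l hl
    simp only [h2 l hl, arrivalExp_const, mul_one]
  rw [Finset.sum_congr rfl h3, Finset.sum_const, nsmul_eq_mul]

lemma tieExp_const {m : ℕ} (c : ℝ) :
    tieExp (fun _ : Fin m → Equiv.Perm (Fin n) => c) = c := by
  have : (Fintype.card (Fin m → Equiv.Perm (Fin n)) : ℝ) ≠ 0 := by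
    exact_mod_cast Fintype.card_ne_zero
  rw [tieExp]
  simp only [Finset.sum_const, Finset.card_univ, nsmul_eq_mul]
  field_simp

lemma tieExp_mono {m : ℕ} {f g : (Fin m → Equiv.Perm (Fin n)) → ℝ} (h : ∀ σ, f σ ≤ g σ) :
    tieExp f ≤ tieExp g :=
  div_le_div_of_nonneg_right (Finset.sum_le_sum fun σ _ => h σ) (by positivity)

lemma tieExp_add {m : ℕ} (f g : (Fin m → Equiv.Perm (Fin n)) → ℝ) :
    tieExp (fun σ => f σ + g σ) = tieExp f + tieExp g := by
  simp [tieExp, Finset.sum_add_distrib, add_div]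

lemma tieExp_sum {m : ℕ} {ι : Type*} (s : Finset ι) (f : ι → (Fin m → Equiv.Perm (Fin n)) → ℝ) :
    tieExp (fun σ => ∑ i ∈ s, f i σ) = ∑ i ∈ s, tieExp (f i) := by
  simp only [tieExp, ← Finset.sum_div]
  rw [Finset.sum_comm]

lemma abs_tieExp_le {m : ℕ} {f : (Fin m → Equiv.Perm (Fin n)) → ℝ} {C : ℝ}
    (h : ∀ σ, |f σ| ≤ C) : |tieExp f| ≤ C := by
  rw [abs_le]
  constructor
  · calc -C = tieExp (fun _ : Fin m → Equiv.Perm (Fin n) => -C) := (tieExp_const _).symm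
      _ ≤ _ := tieExp_mono fun z => (abs_le.1 (h z)).1
  · calc _ ≤ tieExp (fun _ : Fin m → Equiv.Perm (Fin n) => C) :=
        tieExp_mono fun z => (abs_le.1 (h z)).2
      _ = C := tieExp_const _

end Arrival

/-! ### One uniform price auction -/

section Auction

variable {n r : ℕ} {a : Fin n → Fin r → ℝ} {σ : Equiv.Perm (Fin n)}

lemma Beats.le {p q : Fin n × Fin r} (h : Beats a σ p q) : a q.1 q.2 ≤ a p.1 p.2 := by
  rcases h with h | h
  · exact h.le
  · exact h.1.ge

lemma not_beats_self (p : Fin n × Fin r) : ¬ Beats a σ p p := by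
  simp [Beats]

lemma Beats.trans {p q s : Fin n × Fin r} (h : Beats a σ p q) (h' : Beats a σ q s) :
    Beats a σ p s := by
  obtain ⟨p1, p2⟩ := p
  obtain ⟨q1, q2⟩ := q
  obtain ⟨s1, s2⟩ := s
  simp only [Beats] at *
  rcases h with h | ⟨h, h1 | ⟨rfl, h1⟩⟩ <;> rcases h' with h' | ⟨h', h2 | ⟨rfl, h2⟩⟩
  · exact Or.inl (h'.trans h)
  · exact Or.inl (by linarith)
  · exact Or.inl (by linarith)
  · exact Or.inl (by linarith)
  · exact Or.inr ⟨h.trans h', Or.inl (h1.trans h2)⟩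
  · exact Or.inr ⟨h.trans h', Or.inl h1⟩
  · exact Or.inl (by linarith)
  · exact Or.inr ⟨h.trans h', Or.inl h2⟩
  · exact Or.inr ⟨h.trans h', Or.inr ⟨rfl, h1.trans h2⟩⟩

lemma beats_or_beats {p q : Fin n × Fin r} (h : p ≠ q) : Beats a σ p q ∨ Beats a σ q p := by
  obtain ⟨p1, p2⟩ := p
  obtain ⟨q1, q2⟩ := q
  simp only [Beats]
  rcases lt_trichotomy (a p1 p2) (a q1 q2) with h1 | h1 | h1
  · exact Or.inr (Or.inl h1)
  · rcases lt_trichotomy (σ p1) (σ q1) with h2 | h2 | h2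
    · exact Or.inl (Or.inr ⟨h1, Or.inl h2⟩)
    · obtain rfl := σ.injective h2
      rcases lt_trichotomy p2 q2 with h3 | rfl | h3
      · exact Or.inl (Or.inr ⟨h1, Or.inr ⟨rfl, h3⟩⟩)
      · exact absurd rfl h
      · exact Or.inr (Or.inr ⟨h1.symm, Or.inr ⟨rfl, h3⟩⟩)
    · exact Or.inr (Or.inr ⟨h1.symm, Or.inl h2⟩)
  · exact Or.inl (Or.inl h1)

lemma ncard_beats_lt {p q : Fin n × Fin r} (h : Beats a σ p q) :
    Set.ncard {s | Beats a σ s p} < Set.ncard {s | Beats a σ s q} := by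
  refine Set.ncard_lt_ncard ⟨fun s hs => Beats.trans hs h, fun hsub => ?_⟩ (Set.toFinite _)
  exact not_beats_self p (hsub h)

/-- The position of a bid in the processing order determines the bid. -/
lemma ncard_beats_injective :
    Function.Injective fun p : Fin n × Fin r => Set.ncard {s | Beats a σ s p} := by
  intro p q h
  by_contra hne
  rcases beats_or_beats (a := a) (σ := σ) hne with h' | h'
  · exact (ncard_beats_lt h').ne h
  · exact (ncard_beats_lt h').ne h.symm

lemma ncard_beats_lt_mul (p : Fin n × Fin r) : Set.ncard {s | Beats a σ s p} < n * r := by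
  have : Set.ncard {s | Beats a σ s p} < Set.ncard (Set.univ : Set (Fin n × Fin r)) :=
    Set.ncard_lt_ncard ⟨Set.subset_univ _, fun hsub => not_beats_self p (hsub (Set.mem_univ p))⟩
      (Set.toFinite _)
  simpa [Set.ncard_univ] using this

/-- Every position is taken by some bid. -/
lemma exists_ncard_beats_eq {x : ℕ} (hx : x < n * r) :
    ∃ p : Fin n × Fin r, Set.ncard {s | Beats a σ s p} = x := by
  let f : Fin n × Fin r → Fin (n * r) := fun p => ⟨_, ncard_beats_lt_mul (a := a) (σ := σ) p⟩
  have hf : Function.Bijective f := by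
    rw [Fintype.bijective_iff_injective_and_card]
    refine ⟨fun p q h => ncard_beats_injective (a := a) (σ := σ) (Fin.mk.inj_iff.1 h), by simp⟩
  obtain ⟨p, hp⟩ := hf.2 ⟨x, hx⟩
  exact ⟨p, Fin.mk.inj_iff.1 hp⟩

open Classical in
lemma card_wins_le (K : ℕ) (a : Fin n → Fin r → ℝ) (σ : Equiv.Perm (Fin n)) :
    (Finset.univ.filter fun p => Wins K a σ p).card ≤ K := by
  conv_rhs => rw [← Finset.card_range K]
  refine Finset.card_le_card_of_injOn (fun p => Set.ncard {s | Beats a σ s p}) ?_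
    (ncard_beats_injective.injOn)
  intro p hp
  exact Finset.mem_coe.2 (Finset.mem_range.2 (Finset.mem_filter.1 (Finset.mem_coe.1 hp)).2)

open Classical in
lemma le_card_wins {K : ℕ} {p : Fin n × Fin r} (hp : ¬ Wins K a σ p) :
    K ≤ (Finset.univ.filter fun p => Wins K a σ p).card := by
  conv_lhs => rw [← Finset.card_range K]
  refine Finset.card_le_card_of_surjOn (fun p => Set.ncard {s | Beats a σ s p}) ?_
  intro x hx
  have hx' : x < K := by simpa using hx
  have hK : K ≤ Set.ncard {s | Beats a σ s p} := not_lt.1 hp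
  obtain ⟨q, hq⟩ := exists_ncard_beats_eq (a := a) (σ := σ)
    (hx'.trans_le (hK.trans (ncard_beats_lt_mul p).le))
  exact ⟨q, Finset.mem_coe.2 (Finset.mem_filter.2 ⟨Finset.mem_univ _, hq.trans_lt hx'⟩), hq⟩

lemma bid_le_of_wins_of_not_wins {K : ℕ} {p q : Fin n × Fin r} (hp : Wins K a σ p)
    (hq : ¬ Wins K a σ q) : a q.1 q.2 ≤ a p.1 p.2 := by
  have hne : p ≠ q := by rintro rfl; exact hq hp
  rcases beats_or_beats (a := a) (σ := σ) hne with h | h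
  · exact h.le
  · exact absurd ((ncard_beats_lt h).trans hp) hq

lemma le_price {K : ℕ} {p : Fin n × Fin r} (hp : ¬ Wins K a σ p) :
    a p.1 p.2 ≤ price K a σ := by
  classical
  have := le_ciSup (f := fun p : Fin n × Fin r => if Wins K a σ p then 0 else a p.1 p.2)
    (Set.finite_range _).bddAbove p
  simpa [price, hp] using this

lemma price_nonneg (ha : ∀ i t, 0 ≤ a i t) (K : ℕ) (σ : Equiv.Perm (Fin n)) :
    0 ≤ price K a σ := by
  refine Real.iSup_nonneg fun p => ?_
  split_ifs
  · exact le_rfl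
  · exact ha _ _

/-- The price is `0` or a losing bid. -/
lemma exists_eq_price_of_pos {K : ℕ} (h : 0 < price K a σ) :
    ∃ p : Fin n × Fin r, ¬ Wins K a σ p ∧ a p.1 p.2 = price K a σ := by
  classical
  have hne : Nonempty (Fin n × Fin r) := by
    by_contra hemp
    rw [not_nonempty_iff] at hemp
    rw [price, Real.iSup_of_isEmpty] at h
    exact h.false
  obtain ⟨p, hp⟩ := exists_eq_ciSup_of_finite
    (f := fun p : Fin n × Fin r => if Wins K a σ p then 0 else a p.1 p.2)
  change _ = price K a σ at hp
  by_cases hw : Wins K a σ p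
  · rw [if_pos hw] at hp
    exact absurd h (by rw [← hp]; exact lt_irrefl _)
  · rw [if_neg hw] at hp
    exact ⟨p, hw, hp⟩

lemma price_le_of_wins (ha : ∀ i t, 0 ≤ a i t) {K : ℕ} {p : Fin n × Fin r}
    (hp : Wins K a σ p) : price K a σ ≤ a p.1 p.2 := by
  rcases (price_nonneg ha K σ).eq_or_lt with h | h
  · rw [← h]; exact ha _ _
  · obtain ⟨q, hq, hqe⟩ := exists_eq_price_of_pos h
    rw [← hqe]
    exact bid_le_of_wins_of_not_wins hp hq

open Classical in
/-- The price is the `(K + 1)`-th highest bid: a positive threshold `θ` is at most the price exactly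
when more than `K` bids reach it. -/
lemma le_price_iff {K : ℕ} {θ : ℝ} (hθ : 0 < θ) :
    θ ≤ price K a σ ↔ K < (Finset.univ.filter fun p : Fin n × Fin r => θ ≤ a p.1 p.2).card := by
  constructor
  · intro h
    obtain ⟨p, hp, hpe⟩ := exists_eq_price_of_pos (hθ.trans_le h)
    have hK : K ≤ Set.ncard {s | Beats a σ s p} := not_lt.1 hp
    rw [Set.ncard_eq_toFinset_card' ] at hK
    refine hK.trans_lt (Finset.card_lt_card ⟨fun q hq => ?_, fun hsub => ?_⟩)
    · have hq' : Beats a σ q p := by simpa using hq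
      have := hq'.le
      simp only [Finset.mem_filter, Finset.mem_univ, true_and]
      linarith
    · have : p ∈ Set.toFinset {s | Beats a σ s p} := hsub (by simp [hpe, h])
      exact not_beats_self p (by simpa using this)
  · intro h
    have : ∃ p : Fin n × Fin r, θ ≤ a p.1 p.2 ∧ ¬ Wins K a σ p := by
      by_contra hcon
      push Not at hcon
      refine absurd (card_wins_le K a σ) (not_le.2 (h.trans_le (Finset.card_le_card ?_)))
      intro p hp
      simp only [Finset.mem_filter, Finset.mem_univ, true_and] at hp ⊢
      exact hcon p hp
    obtain ⟨p, hp, hw⟩ := this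
    exact hp.trans (le_price hw)

open Classical in
/-- Prices are compared by counting the bids above each positive threshold. -/
lemma price_le_price {a' : Fin n → Fin r → ℝ} {σ' : Equiv.Perm (Fin n)} {K K' : ℕ}
    (ha' : ∀ i t, 0 ≤ a' i t)
    (h : ∀ θ : ℝ, 0 < θ → θ ≤ price K a σ →
      K < (Finset.univ.filter fun p : Fin n × Fin r => θ ≤ a p.1 p.2).card →
      K' < (Finset.univ.filter fun p : Fin n × Fin r => θ ≤ a' p.1 p.2).card) :
    price K a σ ≤ price K' a' σ' := by
  rcases le_or_gt (price K a σ) 0 with h0 | h0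
  · exact h0.trans (price_nonneg ha' _ _)
  · exact (le_price_iff h0).2 (h _ h0 le_rfl ((le_price_iff h0).1 le_rfl))

lemma price_mono {a' : Fin n → Fin r → ℝ} (ha' : ∀ i t, 0 ≤ a' i t)
    (h : ∀ i t, a i t ≤ a' i t) (K : ℕ) (σ σ' : Equiv.Perm (Fin n)) :
    price K a σ ≤ price K a' σ' := by
  classical
  refine price_le_price ha' fun θ _ _ hK => hK.trans_le (Finset.card_le_card fun p hp => ?_)
  simp only [Finset.mem_filter, Finset.mem_univ, true_and] at hp ⊢
  exact hp.trans (h _ _)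

/-- Tie-breaking does not affect the price. -/
lemma price_eq_price (ha : ∀ i t, 0 ≤ a i t) (K : ℕ) (σ σ' : Equiv.Perm (Fin n)) :
    price K a σ = price K a σ' :=
  le_antisymm (price_mono ha (fun _ _ => le_rfl) _ _ _) (price_mono ha (fun _ _ => le_rfl) _ _ _)

lemma price_le {C : ℝ} (hC : 0 ≤ C) (ha : ∀ i t, a i t ≤ C) (K : ℕ) (σ : Equiv.Perm (Fin n)) :
    price K a σ ≤ C := by
  refine Real.iSup_le (fun p => ?_) hC
  split_ifs
  · exact hC
  · exact ha _ _

open Classical in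
lemma sum_ncard_wins (K : ℕ) (a : Fin n → Fin r → ℝ) (σ : Equiv.Perm (Fin n)) :
    ∑ i, Set.ncard {t : Fin r | Wins K a σ (i, t)} =
      (Finset.univ.filter fun p => Wins K a σ p).card := by
  rw [Finset.card_filter, Fintype.sum_prod_type]
  refine Finset.sum_congr rfl fun i _ => ?_
  rw [← Finset.card_filter, Set.ncard_eq_toFinset_card']
  congr 1
  ext t
  simp

/-- The auction sells all `K` units unless the price is `0`. -/
lemma mul_price_le_sum (ha : ∀ i t, 0 ≤ a i t) (K : ℕ) (σ : Equiv.Perm (Fin n)) :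
    K * price K a σ ≤ ∑ i, (Set.ncard {t : Fin r | Wins K a σ (i, t)} : ℝ) * price K a σ := by
  classical
  rcases (price_nonneg ha K σ).eq_or_lt with h | h
  · simp [← h]
  · obtain ⟨p, hp, -⟩ := exists_eq_price_of_pos h
    rw [← Finset.sum_mul]
    refine mul_le_mul_of_nonneg_right ?_ h.le
    rw [← Nat.cast_sum, sum_ncard_wins]
    exact_mod_cast le_card_wins hp

/-- A bidder whose bids are all `0` pays nothing. -/
lemma ncard_mul_price_eq_zero (ha : ∀ i t, 0 ≤ a i t) (K : ℕ) (σ : Equiv.Perm (Fin n))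
    {i : Fin n} (hi : ∀ t, a i t = 0) :
    (Set.ncard {t : Fin r | Wins K a σ (i, t)} : ℝ) * price K a σ = 0 := by
  rcases Set.eq_empty_or_nonempty {t : Fin r | Wins K a σ (i, t)} with h | ⟨t, ht⟩
  · simp [h]
  · have h1 := price_le_of_wins ha ht
    rw [hi] at h1
    rw [le_antisymm h1 (price_nonneg ha K σ), mul_zero]

/-- A bidder who bids `b` on `y` units and `0` on the others pays for at most `y` units. -/
lemma ncard_mul_price_le (ha : ∀ i t, 0 ≤ a i t) (K : ℕ) (σ : Equiv.Perm (Fin n))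
    {i : Fin n} {b : ℝ} {y : ℕ} (hi : ∀ t : Fin r, a i t = if (t : ℕ) < y then b else 0) :
    (Set.ncard {t : Fin r | Wins K a σ (i, t)} : ℝ) * price K a σ ≤ y * price K a σ := by
  by_cases h : Set.ncard {t : Fin r | Wins K a σ (i, t)} ≤ y
  · exact mul_le_mul_of_nonneg_right (by exact_mod_cast h) (price_nonneg ha K σ)
  · have : ∃ t : Fin r, Wins K a σ (i, t) ∧ y ≤ t := by
      by_contra hcon
      push Not at hcon
      apply h
      have hsub : {t : Fin r | Wins K a σ (i, t)} ⊆ {t : Fin r | (t : ℕ) < y} := hcon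
      refine (Set.ncard_le_ncard hsub (Set.toFinite _)).trans ?_
      calc Set.ncard {t : Fin r | (t : ℕ) < y}
          = Set.ncard (Fin.val '' {t : Fin r | (t : ℕ) < y}) :=
            (Set.ncard_image_of_injective _ Fin.val_injective).symm
        _ ≤ Set.ncard (Set.Iio y) :=
            Set.ncard_le_ncard (by rintro _ ⟨t, ht, rfl⟩; exact ht) (Set.toFinite _)
        _ = y := by simp [Set.ncard_eq_toFinset_card']
    obtain ⟨t, ht, hy⟩ := this
    have h1 := price_le_of_wins ha ht
    rw [hi, if_neg (not_lt.2 hy)] at h1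
    rw [le_antisymm h1 (price_nonneg ha K σ), mul_zero, mul_zero]

/-- A bidder who bids `b` on `y` units and gets fewer than `y` of them faces a price of at least
`b`. -/
lemma ncard_mul_price_add_le (ha : ∀ i t, 0 ≤ a i t) (K : ℕ) (σ : Equiv.Perm (Fin n))
    {i : Fin n} {b : ℝ} {y : ℕ} (hy : y ≤ r)
    (hi : ∀ t : Fin r, a i t = if (t : ℕ) < y then b else 0)
    (hlt : Set.ncard {t : Fin r | Wins K a σ (i, t)} < y) :
    (Set.ncard {t : Fin r | Wins K a σ (i, t)} : ℝ) * price K a σ + b ≤ y * price K a σ := by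
  have : ∃ t : Fin r, ¬ Wins K a σ (i, t) ∧ (t : ℕ) < y := by
    by_contra hcon
    push Not at hcon
    refine absurd hlt (not_lt.2 ?_)
    have hsub : Set.range (Fin.castLE hy) ⊆ {t : Fin r | Wins K a σ (i, t)} := by
      rintro _ ⟨t, rfl⟩
      by_contra hw
      exact absurd (hcon _ hw) (not_le.2 t.2)
    calc y = Set.ncard (Set.range (Fin.castLE hy)) := by
          rw [← Set.image_univ, Set.ncard_image_of_injective _ (Fin.castLE_injective hy)]
          simp [Set.ncard_univ]
      _ ≤ _ := Set.ncard_le_ncard hsub (Set.toFinite _)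
  obtain ⟨t, ht, hty⟩ := this
  have h1 := le_price ht
  rw [hi, if_pos hty] at h1
  have h2 : ((Set.ncard {t : Fin r | Wins K a σ (i, t)} : ℝ) + 1) ≤ y := by exact_mod_cast hlt
  have h3 := mul_le_mul_of_nonneg_right h2 (price_nonneg ha K σ)
  linarith

end Auction

/-! ### The impact of one bidder on the expected price -/

section Impact

variable {n r : ℕ} {a : Fin n → Fin r → ℝ} {δ B : ℝ}

/-- The price of a good when `T` units are sold and the bids of the bidders who did not arrive are
replaced by `0`. The priority order is irrelevant for the price and set to the identity. -/
noncomputable def noisyPrice (T : ℕ) (a : Fin n → Fin r → ℝ) (z : Fin n → Bool) : ℝ :=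
  price T (fun l t => if z l then a l t else 0) 1

lemma ite_arrival_nonneg (ha : ∀ l t, 0 ≤ a l t) (z : Fin n → Bool) (l : Fin n) (t : Fin r) :
    0 ≤ if z l then a l t else 0 := by
  split_ifs
  · exact ha _ _
  · exact le_rfl

lemma noisyPrice_nonneg (ha : ∀ l t, 0 ≤ a l t) (T : ℕ) (z : Fin n → Bool) :
    0 ≤ noisyPrice T a z := price_nonneg (ite_arrival_nonneg ha z) _ _

lemma noisyPrice_le (hB : 0 ≤ B) (ha : ∀ l t, a l t ≤ B) (T : ℕ) (z : Fin n → Bool) :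
    noisyPrice T a z ≤ B := by
  refine price_le hB (fun l t => ?_) _ _
  split_ifs
  · exact ha _ _
  · exact hB

lemma noisyPrice_update_le (ha : ∀ l t, 0 ≤ a l t) (T : ℕ) (z : Fin n → Bool) (l : Fin n) :
    noisyPrice T a (Function.update z l false) ≤ noisyPrice T a (Function.update z l true) := by
  refine price_mono (ite_arrival_nonneg ha _) (fun l' t => ?_) _ _ _
  by_cases hl : l' = l
  · subst hl; simp [ha]
  · simp [hl]

/-- If the first bid of `l` reaches the price at which `T` units are sold without her, then this
price is still attained when `T + 1` units are sold in her presence. -/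
lemma noisyPrice_update_le_succ (ha : ∀ l t, 0 ≤ a l t) (T : ℕ) (z : Fin n → Bool) (l : Fin n)
    (t₀ : Fin r) (hl : noisyPrice T a (Function.update z l false) ≤ a l t₀) :
    noisyPrice T a (Function.update z l false) ≤
      noisyPrice (T + 1) a (Function.update z l true) := by
  classical
  refine price_le_price (ite_arrival_nonneg ha _) fun θ hθ hle hT => ?_
  refine (Nat.succ_le_of_lt hT).trans_lt
    (Finset.card_lt_card ⟨fun p hp => ?_, fun hsub => ?_⟩)
  · simp only [Finset.mem_filter, Finset.mem_univ, true_and] at hp ⊢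
    by_cases hpl : p.1 = l
    · simp [hpl] at hp; linarith
    · simpa [hpl] using hp
  · have h1 : θ ≤ a l t₀ := hle.trans hl
    have := @hsub (l, t₀) (by simp [h1])
    simp at this
    linarith

/-- At least `N` elements have fewer than `N` elements strictly above them. -/
lemma le_card_top (f : Fin n → ℝ) {N : ℕ} (hN : N ≤ n) :
    N ≤ (Finset.univ.filter fun l =>
      (Finset.univ.filter fun l' => f l < f l').card < N).card := by
  set A := Finset.univ.filter fun l => (Finset.univ.filter fun l' => f l < f l').card < N with hA
  by_contra! hlt
  have hne : Aᶜ.Nonempty := by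
    rw [← Finset.card_pos, Finset.card_compl, Fintype.card_fin]
    omega
  obtain ⟨l, hl, hmax⟩ := Finset.exists_max_image Aᶜ f hne
  rw [Finset.mem_compl] at hl
  apply hl
  rw [hA, Finset.mem_filter]
  refine ⟨Finset.mem_univ _, lt_of_le_of_lt (Finset.card_le_card fun l' hl' => ?_) hlt⟩
  by_contra hmem
  have := hmax l' (Finset.mem_compl.2 hmem)
  simp only [Finset.mem_filter, Finset.mem_univ, true_and] at hl'
  linarith

/-- Whoever arrives, the price does not exceed the first bid of a bidder with at most `T / r`
bidders above her. -/
lemma noisyPrice_le_first (hr : 0 < r) (ha : ∀ l t, 0 ≤ a l t) (hanti : ∀ l, Antitone (a l))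
    (T : ℕ) (z : Fin n → Bool) (l : Fin n)
    (hl : (Finset.univ.filter fun l' => a l ⟨0, hr⟩ < a l' ⟨0, hr⟩).card < T / r + 1) :
    noisyPrice T a z ≤ a l ⟨0, hr⟩ := by
  classical
  by_contra! hlt
  have hpos : 0 < noisyPrice T a z := (ha _ _).trans_lt hlt
  have h1 := (le_price_iff hpos).1 (le_refl (noisyPrice T a z))
  refine absurd h1 (not_lt.2 ?_)
  calc _ ≤ ((Finset.univ.filter fun l' => a l ⟨0, hr⟩ < a l' ⟨0, hr⟩) ×ˢ
        (Finset.univ : Finset (Fin r))).card := by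
        refine Finset.card_le_card fun p hp => ?_
        simp only [Finset.mem_filter, Finset.mem_univ, true_and, Finset.mem_product, and_true]
          at hp ⊢
        by_cases hz : z p.1
        · rw [if_pos hz] at hp
          exact hlt.trans_le (hp.trans (hanti p.1 (Fin.mk_le_of_le_val (Nat.zero_le _))))
        · rw [if_neg hz] at hp
          linarith
    _ ≤ T / r * r := by
        rw [Finset.card_product, Finset.card_univ, Fintype.card_fin]
        exact Nat.mul_le_mul_right _ (by omega)
    _ ≤ T := Nat.div_mul_le_self _ _

lemma noisyPrice_eq_zero (ha : ∀ l t, 0 ≤ a l t) {T : ℕ} (hT : n * r ≤ T) (z : Fin n → Bool) :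
    noisyPrice T a z = 0 := by
  classical
  by_contra hne
  have hpos : 0 < noisyPrice T a z := lt_of_le_of_ne (noisyPrice_nonneg ha T z) (Ne.symm hne)
  have h1 := (le_price_iff hpos).1 (le_refl (noisyPrice T a z))
  refine absurd (hT.trans_lt h1) (not_lt.2 ((Finset.card_le_univ _).trans ?_))
  simp

/-- One more unit changes the expected price by `O(1 / √T)`: each of the `T / r + 1` bidders with
the highest first bids moves `h = π_T + π_{T+1}` by at least `π_T - π_{T+1}`, while the sum of the
influences of these bidders on the bounded function `h` is controlled by the covariance of `h` with
the number of them who arrive. -/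
lemma arrivalExp_noisyPrice_sub_succ_le (hr : 0 < r) (h0 : 0 < δ) (h1 : δ < 1)
    (ha : ∀ l t, 0 ≤ a l t) (hanti : ∀ l, Antitone (a l)) (hB : 0 ≤ B) (haB : ∀ l t, a l t ≤ B)
    (T : ℕ) :
    arrivalExp δ (fun z => noisyPrice T a z - noisyPrice (T + 1) a z) ≤
      B / √((T + 1) / r * (δ * (1 - δ))) := by
  have hc : 0 < δ * (1 - δ) := mul_pos h0 (by linarith)
  -- With at most `T / r` bidders there are at most `T` bids, and both prices vanish.
  by_cases hn : n < T / r + 1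
  · have hT : n * r ≤ T := (Nat.mul_le_mul_right r (by omega : n ≤ T / r)).trans
      (Nat.div_mul_le_self _ _)
    simp only [noisyPrice_eq_zero ha hT, noisyPrice_eq_zero ha (hT.trans (Nat.le_succ T)), sub_self,
      arrivalExp_const]
    positivity
  have hcard := le_card_top (fun l => a l ⟨0, hr⟩) (not_lt.1 hn)
  set A := Finset.univ.filter fun l =>
    (Finset.univ.filter fun l' => a l ⟨0, hr⟩ < a l' ⟨0, hr⟩).card < T / r + 1 with hA
  have hNT : ((T : ℝ) + 1) / r ≤ A.card := by
    have h2 : T + 1 ≤ A.card * r := by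
      calc T + 1 ≤ (T / r + 1) * r := by
            have := Nat.lt_div_mul_add hr (a := T); rw [Nat.add_mul]; omega
        _ ≤ _ := Nat.mul_le_mul_right _ hcard
    rw [div_le_iff₀ (by exact_mod_cast hr)]
    exact_mod_cast h2
  -- Subtracting `B` centres `π_T + π_{T+1}`, so that `|h| ≤ B`; derivatives are not affected.
  set h : (Fin n → Bool) → ℝ := fun z => noisyPrice T a z + noisyPrice (T + 1) a z - B with hh
  set Y : (Fin n → Bool) → ℝ := fun z => ∑ l ∈ A, (((if z l then 1 else 0) : ℝ) - (1 - δ)) with hY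
  set s : ℝ := √(A.card * (δ * (1 - δ))) with hs
  have hT0 : (0 : ℝ) < (T + 1) / r := by
    have : (0 : ℝ) < r := by exact_mod_cast hr
    positivity
  have hs2 : s ^ 2 = A.card * (δ * (1 - δ)) := Real.sq_sqrt (by positivity)
  have hspos : 0 < s := Real.sqrt_pos.2 (mul_pos (hT0.trans_le hNT) hc)
  set E := arrivalExp δ (fun z => noisyPrice T a z - noisyPrice (T + 1) a z) with hE
  have hlow : s ^ 2 * E ≤ arrivalExp δ fun z => Y z * h z := by
    have e1 : (arrivalExp δ fun z => Y z * h z) = ∑ l ∈ A, δ * (1 - δ) *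
        arrivalExp δ (fun z => h (Function.update z l true) - h (Function.update z l false)) := by
      simp only [← arrivalExp_centered_mul, ← arrivalExp_sum, hY, Finset.sum_mul]
    rw [e1, hs2, mul_assoc, ← nsmul_eq_mul, ← Finset.sum_const]
    refine Finset.sum_le_sum fun l hl => mul_le_mul_of_nonneg_left ?_ hc.le
    refine arrivalExp_mono h0.le h1.le fun z => ?_
    have hfirst := noisyPrice_le_first hr ha hanti T (Function.update z l false) l
      (Finset.mem_filter.1 hl).2
    have k1 := noisyPrice_update_le_succ ha T z l _ hfirst
    have k2 := noisyPrice_update_le ha T z l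
    have k3 := noisyPrice_update_le ha (T + 1) z l
    simp only [hh]
    cases hz : z l
    · have hzz : Function.update z l false = z := by rw [← hz]; exact Function.update_eq_self l z
      rw [hzz] at k1 k2 k3 ⊢
      linarith
    · have hzz : Function.update z l true = z := by rw [← hz]; exact Function.update_eq_self l z
      rw [hzz] at k1 k2 k3 ⊢
      linarith
  have hupp : (arrivalExp δ fun z => Y z * h z) ≤ B * s := by
    -- The bound `|Y| ≤ Y ^ 2 / (2 s) + s / 2` replaces the Cauchy-Schwarz inequality.
    have e2 : arrivalExp δ (fun z => B / (2 * s) * Y z ^ 2 + B * s / 2) = B * s := by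
      rw [arrivalExp_add, arrivalExp_const_mul, arrivalExp_const, hY, arrivalExp_centered_sq, ← hs2]
      field_simp
      ring
    rw [← e2]
    refine arrivalExp_mono h0.le h1.le fun z => ?_
    have hb1 := noisyPrice_nonneg ha T z
    have hb2 := noisyPrice_nonneg ha (T + 1) z
    have hb3 := noisyPrice_le hB haB T z
    have hb4 := noisyPrice_le hB haB (T + 1) z
    have habs : |h z| ≤ B := by
      simp only [hh]
      rw [abs_le]
      constructor <;> linarith
    calc Y z * h z ≤ |Y z| * |h z| := by rw [← abs_mul]; exact le_abs_self _
      _ ≤ |Y z| * B := mul_le_mul_of_nonneg_left habs (abs_nonneg _)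
      _ ≤ (Y z ^ 2 / (2 * s) + s / 2) * B := by
          refine mul_le_mul_of_nonneg_right ?_ hB
          rw [← sq_abs (Y z)]
          have : |Y z| ^ 2 / (2 * s) + s / 2 - |Y z| = (|Y z| - s) ^ 2 / (2 * s) := by
            field_simp
            ring
          have h3 : 0 ≤ (|Y z| - s) ^ 2 / (2 * s) := by positivity
          linarith
      _ = _ := by ring
  calc E ≤ B / s := by
        rw [le_div_iff₀ hspos]
        have : s * (E * s) ≤ s * B := by nlinarith
        exact le_of_mul_le_mul_left this hspos
    _ ≤ _ := by
        refine div_le_div_of_nonneg_left hB (Real.sqrt_pos.2 (mul_pos hT0 hc))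
          (Real.sqrt_le_sqrt ?_)
        exact mul_le_mul_of_nonneg_right hNT hc.le

lemma arrivalExp_noisyPrice_sub_add_le (hr : 0 < r) (h0 : 0 < δ) (h1 : δ < 1)
    (ha : ∀ l t, 0 ≤ a l t) (hanti : ∀ l, Antitone (a l)) (hB : 0 ≤ B) (haB : ∀ l t, a l t ≤ B)
    (T d : ℕ) :
    arrivalExp δ (fun z => noisyPrice T a z - noisyPrice (T + d) a z) ≤
      d * (B / √((T + 1) / r * (δ * (1 - δ)))) := by
  have hc : 0 < δ * (1 - δ) := mul_pos h0 (by linarith)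
  have hr' : (0 : ℝ) < r := by exact_mod_cast hr
  induction d with
  | zero => simp [arrivalExp_const]
  | succ d ih =>
    have h2 := arrivalExp_noisyPrice_sub_succ_le hr h0 h1 ha hanti hB haB (T + d)
    have h3 : B / √((((T + d : ℕ) : ℝ) + 1) / r * (δ * (1 - δ))) ≤
        B / √((T + 1) / r * (δ * (1 - δ))) := by
      refine div_le_div_of_nonneg_left hB (Real.sqrt_pos.2 (by positivity)) (Real.sqrt_le_sqrt ?_)
      refine mul_le_mul_of_nonneg_right ?_ hc.le
      refine div_le_div_of_nonneg_right ?_ hr'.le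
      push_cast
      have : (0 : ℝ) ≤ d := Nat.cast_nonneg d
      linarith
    rw [arrivalExp_sub] at ih h2 ⊢
    push_cast
    rw [← add_assoc T d 1]
    linarith

end Impact

/-! ### Optimal allocations -/

section Opt

variable {n m r : ℕ} {k : Fin m → ℕ} {H B ρ δ ε : ℝ}

lemma finite_feasible (k : Fin m → ℕ) :
    {x : Fin n → Fin m → ℕ | ∀ j, ∑ i, x i j ≤ k j}.Finite := by
  refine (Set.finite_Iic (fun (_ : Fin n) j => k j)).subset fun x hx i j => ?_
  exact (Finset.single_le_sum (f := fun i => x i j) (fun _ _ => Nat.zero_le _)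
    (Finset.mem_univ i)).trans (hx j)

lemma exists_optWelfare_eq (k : Fin m → ℕ) (u : Fin n → Val m) :
    ∃ x : Fin n → Fin m → ℕ, (∀ j, ∑ i, x i j ≤ k j) ∧ optWelfare k u = ∑ i, u i (x i) := by
  have hfin : {w | ∃ x : Fin n → Fin m → ℕ, (∀ j, ∑ i, x i j ≤ k j) ∧
      w = ∑ i, u i (x i)}.Finite := by
    refine ((finite_feasible (n := n) k).image fun x => ∑ i, u i (x i)).subset ?_
    rintro w ⟨x, hx, rfl⟩
    exact ⟨x, hx, rfl⟩
  have hne : {w | ∃ x : Fin n → Fin m → ℕ, (∀ j, ∑ i, x i j ≤ k j) ∧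
      w = ∑ i, u i (x i)}.Nonempty := ⟨_, 0, by simp, rfl⟩
  exact hne.csSup_mem hfin

/-- Some optimal allocation gives nobody more than `r` units of a good. -/
lemma exists_optimal_allocation {v : Fin n → Val m} (hv : ∀ i, v i ∈ valuations m r H ρ)
    (z : Fin n → Bool) :
    ∃ x : Fin n → Fin m → ℕ, (∀ j, ∑ i, x i j ≤ k j) ∧ (∀ i j, x i j ≤ r) ∧
      (optWelfare k fun i x => if z i then v i x else 0) =
        ∑ i, if z i then v i (x i) else 0 := by
  obtain ⟨x, hx, he⟩ := exists_optWelfare_eq k fun i x => if z i then v i x else 0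
  refine ⟨fun i j => min (x i j) r, fun j => (Finset.sum_le_sum fun i _ => min_le_left _ _).trans
    (hx j), fun i j => min_le_right _ _, ?_⟩
  rw [he]
  exact Finset.sum_congr rfl fun i _ => by rw [(hv i).2.2.1 (x i)]

lemma le_of_mem_valuations {v : Val m} (hv : v ∈ valuations m r H ρ) (j : Fin m) : ρ ≤ H := by
  have h1 := hv.2.2.2 (Pi.single j 1) (by simp)
  exact h1.trans (hv.2.1 _).2

end Opt

/-! ### Value and price at a deviation -/

section Deviation

variable {n m r : ℕ} {k : Fin m → ℕ} {H B ρ δ ε : ℝ}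

lemma bid_nonneg (s : Bid m r B) (j : Fin m) (t : Fin r) : 0 ≤ s.1 j t := ((s.2 j).2 t).1

lemma bid_le (s : Bid m r B) (j : Fin m) (t : Fin r) : s.1 j t ≤ B := ((s.2 j).2 t).2.le

lemma arriving_nonneg (s : Fin n → Bid m r B) (z : Fin n → Bool) (i : Fin n) (j : Fin m)
    (t : Fin r) : 0 ≤ arriving s z i j t := by
  rw [arriving]
  split_ifs
  · exact bid_nonneg _ _ _
  · exact le_rfl

lemma price_arriving (s : Fin n → Bid m r B) (z : Fin n → Bool) (K : ℕ) (j : Fin m)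
    (σ : Equiv.Perm (Fin n)) :
    price K (fun l => arriving s z l j) σ = noisyPrice K (fun l => (s l).1 j) z :=
  price_eq_price (fun _ _ => arriving_nonneg _ _ _ _ _) _ _ _

/-- The strategy that bids `b` on `y j` units of every good `j` and `0` on the others. -/
def flatBid (b : ℝ) (hb : Fin m → 0 ≤ b ∧ b < B) (y : Fin m → ℕ) : Bid m r B :=
  ⟨fun j t => if (t : ℕ) < y j then b else 0, fun j => by
    refine ⟨fun t t' htt => ?_, fun t => ?_⟩
    · have : (t : ℕ) ≤ t' := htt
      dsimp only
      split_ifs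
      · exact le_rfl
      · omega
      · exact (hb j).1
      · exact le_rfl
    · have := hb j
      dsimp only
      split_ifs <;> constructor <;> linarith⟩

/-- Bidding almost `H` or more for the bundle `y` guarantees almost the value of `y` minus its cost
at the realized prices: either `y` is won, or some good has a price that makes `y` worthless. -/
lemma value_sub_payment_flatBid_ge {w : Val m} (hw : w ∈ valuations m r H ρ) {b η : ℝ}
    (hb : Fin m → 0 ≤ b ∧ b < B) (hη : H - b ≤ η) (hη0 : 0 ≤ η) {y : Fin m → ℕ} (hy : ∀ j, y j ≤ r)
    {s : Fin n → Bid m r B} {i : Fin n} (hs : s i = flatBid b hb y) {z : Fin n → Bool}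
    (hz : z i = true) (σ : Fin m → Equiv.Perm (Fin n)) :
    w y - ∑ j, (y j : ℝ) * noisyPrice (k j) (fun l => (s l).1 j) z - (if y = 0 then 0 else η) ≤
      w (bundle k (arriving s z) σ i) - payment k (arriving s z) σ i := by
  have hbid : ∀ j (t : Fin r), arriving s z i j t = if (t : ℕ) < y j then b else 0 := by
    intro j t
    simp [arriving, hz, hs, flatBid]
  have hle : ∀ j, (bundle k (arriving s z) σ i j : ℝ) *
      price (k j) (fun l => arriving s z l j) (σ j) ≤
      y j * noisyPrice (k j) (fun l => (s l).1 j) z := by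
    intro j
    rw [← price_arriving s z (k j) j (σ j)]
    exact ncard_mul_price_le (fun _ _ => arriving_nonneg _ _ _ _ _) (k j) (σ j) (hbid j)
  by_cases hall : ∀ j, y j ≤ bundle k (arriving s z) σ i j
  · have h1 : w y ≤ w (bundle k (arriving s z) σ i) := hw.1 hall
    have h2 : payment k (arriving s z) σ i ≤ _ := Finset.sum_le_sum fun j _ => hle j
    have h3 : 0 ≤ if y = 0 then 0 else η := by
      split_ifs
      · exact le_rfl
      · exact hη0
    linarith
  · push Not at hall
    obtain ⟨j₀, hj₀⟩ := hall
    have hy0 : y ≠ 0 := by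
      rintro rfl
      simp at hj₀
    rw [if_neg hy0]
    have hstrict : (bundle k (arriving s z) σ i j₀ : ℝ) *
        price (k j₀) (fun l => arriving s z l j₀) (σ j₀) + b ≤
        y j₀ * noisyPrice (k j₀) (fun l => (s l).1 j₀) z := by
      rw [← price_arriving s z (k j₀) j₀ (σ j₀)]
      exact ncard_mul_price_add_le (fun _ _ => arriving_nonneg _ _ _ _ _) (k j₀) (σ j₀) (hy j₀)
        (hbid j₀) hj₀
    have h2 : payment k (arriving s z) σ i + b ≤
        ∑ j, (y j : ℝ) * noisyPrice (k j) (fun l => (s l).1 j) z := by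
      rw [payment, ← Finset.add_sum_erase _ _ (Finset.mem_univ j₀),
        ← Finset.add_sum_erase (a := j₀) _ (fun j => (y j : ℝ) * noisyPrice (k j) _ z)
          (Finset.mem_univ j₀)]
      have := Finset.sum_le_sum (s := Finset.univ.erase j₀) fun j _ => hle j
      linarith
    have h3 := (hw.2.1 (bundle k (arriving s z) σ i)).1
    have h4 := (hw.2.1 y).2
    linarith

/-- Whatever one bidder bids, the price is at most the price at which `r` fewer units are sold
without her. -/
lemma noisyPrice_le_sub {a a' : Fin n → Fin r → ℝ} (ha : ∀ l t, 0 ≤ a l t) {K : ℕ} (hK : r ≤ K)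
    (i : Fin n) (haa : ∀ l, l ≠ i → a' l = a l) (z : Fin n → Bool) :
    noisyPrice K a' z ≤ noisyPrice (K - r) a (Function.update z i false) := by
  classical
  refine price_le_price (ite_arrival_nonneg ha _) fun θ hθ _ hT => ?_
  have hsub : (Finset.univ.filter fun p : Fin n × Fin r =>
      θ ≤ if z p.1 then a' p.1 p.2 else 0) ⊆
      (Finset.univ.filter fun p : Fin n × Fin r =>
        θ ≤ if Function.update z i false p.1 then a p.1 p.2 else 0) ∪
      ({i} : Finset (Fin n)) ×ˢ (Finset.univ : Finset (Fin r)) := by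
    intro p hp
    simp only [Finset.mem_filter, Finset.mem_univ, true_and, Finset.mem_union, Finset.mem_product,
      Finset.mem_singleton, and_true] at hp ⊢
    by_cases hpi : p.1 = i
    · exact Or.inr hpi
    · left
      rw [Function.update_of_ne hpi, ← haa _ hpi]
      exact hp
  have h1 := (Finset.card_le_card hsub).trans (Finset.card_union_le _ _)
  rw [Finset.card_product, Finset.card_singleton, Finset.card_univ, Fintype.card_fin, one_mul] at h1
  omega

/-- In expectation over arrivals, removing a bidder and `r` units of a good raises the price by
`O(r / √K)` at most. -/
lemma arrivalExp_noisyPrice_le {a : Fin n → Fin r → ℝ} (hr : 0 < r) (h0 : 0 < δ) (h1 : δ < 1)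
    (ha : ∀ l t, 0 ≤ a l t) (hanti : ∀ l, Antitone (a l)) (hB : 0 ≤ B) (haB : ∀ l t, a l t ≤ B)
    {K : ℕ} (hK : r ≤ K) (i : Fin n) :
    arrivalExp δ (fun z => noisyPrice (K - r) a (Function.update z i false)) ≤
      arrivalExp δ (fun z => noisyPrice K a z) +
        r * (B / √((K - r + 1) / r * (δ * (1 - δ)))) := by
  set a₀ := Function.update a i 0 with ha₀
  have heq : ∀ T z, noisyPrice T a (Function.update z i false) = noisyPrice T a₀ z := by
    intro T z
    rw [noisyPrice, noisyPrice]
    congr 1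
    ext l t
    by_cases hl : l = i
    · subst hl; simp [ha₀]
    · simp [ha₀, hl]
  have hcases : ∀ l, a₀ l = a l ∨ a₀ l = 0 := by
    intro l
    by_cases hl : l = i
    · subst hl; simp [ha₀]
    · simp [ha₀, hl]
  have k1 := arrivalExp_noisyPrice_sub_add_le (a := a₀) hr h0 h1
    (fun l t => by rcases hcases l with h | h <;> simp [h, ha])
    (fun l => by
      rcases hcases l with h | h
      · rw [h]; exact hanti l
      · rw [h]; exact antitone_const) hB
    (fun l t => by rcases hcases l with h | h <;> simp [h, haB, hB]) (K - r) r
  have k2 : arrivalExp δ (fun z => noisyPrice K a₀ z) ≤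
      arrivalExp δ (fun z => noisyPrice K a z) := by
    refine arrivalExp_mono h0.le h1.le fun z => ?_
    refine price_mono (ite_arrival_nonneg ha z) (fun l t => ?_) _ _ _
    have := ha l t
    rcases hcases l with h | h <;> split_ifs <;> simp [h, this]
  rw [Nat.sub_add_cancel hK, arrivalExp_sub, Nat.cast_sub hK] at k1
  simp only [heq]
  linarith

/-- The auctioneer's revenue is at least that of selling all units at the realized prices. -/
lemma sum_mul_noisyPrice_le_revenue (h0 : 0 ≤ δ) (h1 : δ ≤ 1) (s : Fin n → Bid m r B) :
    ∑ j, (k j : ℝ) * arrivalExp δ (fun z => noisyPrice (k j) (fun l => (s l).1 j) z) ≤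
      revenue k δ s := by
  simp only [← arrivalExp_const_mul, ← arrivalExp_sum]
  refine arrivalExp_mono h0 h1 fun z => ?_
  rw [← tieExp_const (n := n) (m := m) (∑ j, (k j : ℝ) * _)]
  refine tieExp_mono fun σ => ?_
  simp only [payment]
  rw [Finset.sum_comm]
  refine Finset.sum_le_sum fun j _ => ?_
  rw [← price_arriving s z (k j) j (σ j)]
  exact mul_price_le_sum (fun _ _ => arriving_nonneg _ _ _ _ _) (k j) (σ j)

end Deviation

/-! ### Smoothness -/

section Smooth

variable {n m r : ℕ} {k : Fin m → ℕ} {H B ρ δ ε : ℝ}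

/-- Under the supply condition, the price impact times the at most `m * r` units of a bundle is at
most `ρ * ε / 2`. -/
lemma impact_le (hr : 0 < r) (h0 : 0 < δ) (h1 : δ < 1) (hρ : 0 < ρ) (hε : 0 < ε)
    (hm : 0 < m) {K : ℕ} (hrK : r ≤ K)
    (hK : 4 * (m : ℝ) ^ 2 * B ^ 2 * (r : ℝ) ^ 5 ≤
      ε ^ 2 * ρ ^ 2 * (δ * (1 - δ)) * (K - r + 1)) :
    r * (B / √((K - r + 1) / r * (δ * (1 - δ)))) ≤ ρ * ε / (2 * m * r) := by
  have hc : 0 < δ * (1 - δ) := mul_pos h0 (by linarith)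
  have hr' : (0 : ℝ) < r := by exact_mod_cast hr
  have hm' : (0 : ℝ) < m := by exact_mod_cast hm
  have hKr : (0 : ℝ) < K - r + 1 := by
    have : (r : ℝ) ≤ K := by exact_mod_cast hrK
    linarith
  set Q := (K - r + 1) / r * (δ * (1 - δ)) with hQ
  have hQ0 : 0 < Q := by positivity
  have h2 : (2 * m * B * r ^ 2) ^ 2 ≤ (ε * ρ * √Q) ^ 2 := by
    rw [mul_pow (ε * ρ), Real.sq_sqrt hQ0.le]
    have h3 : (K - r + 1) * (δ * (1 - δ)) = Q * r := by rw [hQ]; field_simp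
    have h4 : (2 * m * B * r ^ 2) ^ 2 * r ≤ (ε * ρ) ^ 2 * Q * r := by
      calc (2 * m * B * r ^ 2) ^ 2 * r = 4 * (m : ℝ) ^ 2 * B ^ 2 * (r : ℝ) ^ 5 := by ring
        _ ≤ _ := hK
        _ = (ε * ρ) ^ 2 * ((K - r + 1) * (δ * (1 - δ))) := by ring
        _ = _ := by rw [h3]; ring
    exact le_of_mul_le_mul_right h4 hr'
  have h5 := abs_le_of_sq_le_sq' h2 (by positivity)
  rw [← mul_div_assoc, div_le_div_iff₀ (Real.sqrt_pos.2 hQ0) (by positivity)]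
  nlinarith [h5.2]

/-- The smoothness inequality, with the randomized deviation of bidder `i` given by the bids
`d i z` for independently sampled arrivals `z`: bid almost `H` for the bundle of an optimal
allocation for `z` with `i` arriving. Since prices barely react to the deviation, bidder `i`
gets almost the value of that bundle minus its cost at the prices of the profile `s`. -/
theorem exists_deviation (hr : 0 < r) (h0 : 0 < δ) (h1 : δ < 1) (hρ : 0 < ρ) (hHB : H ≤ B)
    (hε : 0 < ε)
    (hk : ρ ≤ H → ∀ j, r ≤ k j ∧ 4 * (m : ℝ) ^ 2 * B ^ 2 * (r : ℝ) ^ 5 ≤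
      ε ^ 2 * ρ ^ 2 * (δ * (1 - δ)) * (k j - r + 1))
    {v : Fin n → Val m} (hv : ∀ i, v i ∈ valuations m r H ρ) :
    ∃ d : Fin n → (Fin n → Bool) → Bid m r B, ∀ s : Fin n → Bid m r B,
      (1 - ε) * expOpt k δ v - revenue k δ s ≤
        ∑ i, arrivalExp δ fun z => utility k δ (Function.update s i (d i z)) i (v i) := by
  choose x hfeas hxr hopt using fun z => exists_optimal_allocation (k := k) hv z
  -- Half of the loss `ρ * ε`, allowed for every non-zero bundle, goes into bidding `η` less than
  -- `H` (bids have to be below `B`), the other half into the price impact.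
  set η := ρ * ε / 2 with hη
  have hη0 : 0 < η := by positivity
  have hb : ∀ i : Fin n, Fin m → 0 ≤ max 0 (H - η) ∧ max 0 (H - η) < B := by
    intro i j
    have := le_of_mem_valuations (hv i) j
    exact ⟨le_max_left _ _, max_lt (by linarith) (by linarith)⟩
  refine ⟨fun i z => flatBid _ (hb i) (x (Function.update z i true) i), fun s => ?_⟩
  set EP : Fin m → ℝ := fun j =>
    arrivalExp δ (fun z => noisyPrice (k j) (fun l => (s l).1 j) z) with hEP
  -- The payoff of a single deviation to the bundle `y`.
  have hdev : ∀ i (y : Fin m → ℕ), (∀ j, y j ≤ r) →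
      (1 - δ) * ((1 - ε) * v i y - ∑ j, (y j : ℝ) * EP j) ≤
        utility k δ (Function.update s i (flatBid _ (hb i) y)) i (v i) := by
    intro i y hy
    -- `U j z` bounds the price after the deviation and does not depend on whether `i` arrives.
    set U : Fin m → (Fin n → Bool) → ℝ := fun j z =>
      noisyPrice (k j - r) (fun l => (s l).1 j) (Function.update z i false) with hU
    have hUle : ∀ j, arrivalExp δ (U j) ≤ EP j + ρ * ε / (2 * m * r) := by
      intro j
      have hH := le_of_mem_valuations (hv i) j
      have hB : 0 ≤ B := by linarith
      obtain ⟨hrK, hK⟩ := hk hH j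
      refine (arrivalExp_noisyPrice_le hr h0 h1 (fun l t => bid_nonneg (s l) j t)
        (fun l => ((s l).2 j).1) hB (fun l t => bid_le (s l) j t) hrK i).trans ?_
      have := impact_le hr h0 h1 hρ hε j.pos hrK hK
      linarith
    have hstep : (1 - δ) * (v i y - ∑ j, (y j : ℝ) * arrivalExp δ (U j) -
        (if y = 0 then 0 else η)) ≤
        utility k δ (Function.update s i (flatBid _ (hb i) y)) i (v i) := by
      have e1 : (1 - δ) * (v i y - ∑ j, (y j : ℝ) * arrivalExp δ (U j) -
          (if y = 0 then 0 else η)) =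
          arrivalExp δ fun z => if z i then
            v i y - ∑ j, (y j : ℝ) * U j z - (if y = 0 then 0 else η) else 0 := by
        rw [arrivalExp_ite_update]
        have hUu : ∀ j z, U j (Function.update z i true) = U j z := by
          intro j z
          simp [hU]
        simp only [hUu, arrivalExp_sub, arrivalExp_sum, arrivalExp_const_mul, arrivalExp_const]
      rw [e1, utility]
      refine arrivalExp_mono h0.le h1.le fun z => ?_
      by_cases hz : z i = true
      · rw [if_pos hz, if_pos hz,
          ← tieExp_const (n := n) (m := m) (v i y - ∑ j, (y j : ℝ) * U j z - _)]
        refine tieExp_mono fun σ => ?_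
        refine le_trans ?_ (value_sub_payment_flatBid_ge (hv i) (hb i)
          (by linarith [le_max_right 0 (H - η)] : H - max 0 (H - η) ≤ η) hη0.le hy
          (Function.update_self i _ s) hz σ)
        have : ∑ j, (y j : ℝ) * noisyPrice (k j)
            (fun l => (Function.update s i (flatBid _ (hb i) y) l).1 j) z ≤
            ∑ j, (y j : ℝ) * U j z := by
          refine Finset.sum_le_sum fun j _ => mul_le_mul_of_nonneg_left ?_ (Nat.cast_nonneg _)
          refine noisyPrice_le_sub (fun l t => bid_nonneg (s l) j t)
            (hk (le_of_mem_valuations (hv i) j) j).1 i (fun l hl => ?_) z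
          rw [Function.update_of_ne hl]
        linarith
      · rw [if_neg hz, if_neg hz]
    refine le_trans (mul_le_mul_of_nonneg_left ?_ (by linarith)) hstep
    by_cases hy0 : y = 0
    · have := (hv i).2.1 0
      subst hy0
      simp
      nlinarith [this.1]
    · rw [if_neg hy0]
      obtain ⟨j₀, -⟩ := Function.ne_iff.1 hy0
      have hm' : (0 : ℝ) < m := by exact_mod_cast j₀.pos
      have hr' : (0 : ℝ) < r := by exact_mod_cast hr
      have hsum : ∑ j, (y j : ℝ) * arrivalExp δ (U j) ≤ ∑ j, (y j : ℝ) * EP j + η := by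
        calc ∑ j, (y j : ℝ) * arrivalExp δ (U j)
            ≤ ∑ j, ((y j : ℝ) * EP j + r * (ρ * ε / (2 * m * r))) := by
              refine Finset.sum_le_sum fun j _ => ?_
              have h3 := mul_le_mul_of_nonneg_left (hUle j) (Nat.cast_nonneg (α := ℝ) (y j))
              have h4 : (y j : ℝ) * (ρ * ε / (2 * m * r)) ≤ r * (ρ * ε / (2 * m * r)) :=
                mul_le_mul_of_nonneg_right (by exact_mod_cast hy j) (by positivity)
              linarith
          _ = _ := by
              rw [Finset.sum_add_distrib, Finset.sum_const, Finset.card_univ, Fintype.card_fin,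
                nsmul_eq_mul, hη]
              congr 1
              field_simp
      have hρv := (hv i).2.2.2 y hy0
      have : ρ * ε ≤ ε * v i y := by nlinarith
      linarith
  calc (1 - ε) * expOpt k δ v - revenue k δ s
      ≤ (1 - ε) * expOpt k δ v - ∑ j, (k j : ℝ) * EP j := by
        have := sum_mul_noisyPrice_le_revenue (k := k) h0.le h1.le s
        linarith
    _ ≤ arrivalExp δ fun z => ∑ i, if z i then
          (1 - ε) * v i (x z i) - ∑ j, (x z i j : ℝ) * EP j else 0 := by
        rw [expOpt, ← arrivalExp_const_mul, ← arrivalExp_const (n := n) (δ := δ) (∑ j, _),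
          ← arrivalExp_sub]
        refine arrivalExp_mono h0.le h1.le fun z => ?_
        have e2 : ∀ i, (if z i then (1 - ε) * v i (x z i) - ∑ j, (x z i j : ℝ) * EP j else 0) =
            (1 - ε) * (if z i then v i (x z i) else 0) -
              ∑ j, (if z i then (x z i j : ℝ) else 0) * EP j := by
          intro i
          split_ifs <;> simp
        simp only [e2, Finset.sum_sub_distrib, ← Finset.mul_sum, ← hopt]
        rw [Finset.sum_comm]
        refine sub_le_sub_left (Finset.sum_le_sum fun j _ => ?_) _
        rw [← Finset.sum_mul]
        refine mul_le_mul_of_nonneg_right ?_ (arrivalExp_nonneg h0.le h1.le fun z =>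
          noisyPrice_nonneg (fun l t => bid_nonneg (s l) j t) _ _)
        calc ∑ i, (if z i then (x z i j : ℝ) else 0) ≤ ∑ i, (x z i j : ℝ) := by
              refine Finset.sum_le_sum fun i _ => ?_
              split_ifs
              · exact le_rfl
              · exact Nat.cast_nonneg _
          _ ≤ k j := by exact_mod_cast hfeas z j
    _ = ∑ i, arrivalExp δ fun z => (1 - δ) * ((1 - ε) * v i (x (Function.update z i true) i) -
          ∑ j, (x (Function.update z i true) i j : ℝ) * EP j) := by
        -- The bundle of `i` counts only if `i` arrives, which has probability `1 - δ`.
        rw [arrivalExp_sum]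
        refine Finset.sum_congr rfl fun i _ => ?_
        rw [arrivalExp_ite_update, ← arrivalExp_const_mul]
    _ ≤ _ := Finset.sum_le_sum fun i _ => arrivalExp_mono h0.le h1.le fun z =>
        hdev i _ fun j => hxr _ _ _

end Smooth

/-! ### Measurability of outcomes -/

section Measurability

variable {α : Type*} [MeasurableSpace α] {n m r : ℕ} {k : Fin m → ℕ} {B δ : ℝ}

lemma measurable_ncard {ι : Type*} [Fintype ι] {P : α → ι → Prop}
    (h : ∀ i, MeasurableSet {x | P x i}) : Measurable fun x => Set.ncard {i | P x i} := by
  classical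
  have : (fun x => Set.ncard {i | P x i}) = fun x => ∑ i, if P x i then 1 else 0 := by
    ext x
    rw [Set.ncard_eq_toFinset_card', ← Finset.card_filter]
    congr 1
    ext i
    simp
  rw [this]
  exact Finset.measurable_sum _ fun i _ => Measurable.ite (h i) measurable_const measurable_const

lemma measurableSet_beats {a : α → Fin n → Fin r → ℝ} (ha : ∀ i t, Measurable fun x => a x i t)
    (σ : Equiv.Perm (Fin n)) (p q : Fin n × Fin r) : MeasurableSet {x | Beats (a x) σ p q} :=
  (measurableSet_lt (ha _ _) (ha _ _)).union
    ((measurableSet_eq_fun (ha _ _) (ha _ _)).inter (MeasurableSet.const _))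

lemma measurableSet_wins {a : α → Fin n → Fin r → ℝ} (ha : ∀ i t, Measurable fun x => a x i t)
    (K : ℕ) (σ : Equiv.Perm (Fin n)) (p : Fin n × Fin r) :
    MeasurableSet {x | Wins K (a x) σ p} :=
  measurableSet_lt (measurable_ncard fun q => measurableSet_beats ha σ q p) measurable_const

lemma measurable_price {a : α → Fin n → Fin r → ℝ} (ha : ∀ i t, Measurable fun x => a x i t)
    (K : ℕ) (σ : Equiv.Perm (Fin n)) : Measurable fun x => price K (a x) σ := by
  classical
  unfold price
  exact Measurable.iSup fun p =>
    Measurable.ite (measurableSet_wins ha K σ p) measurable_const (ha _ _)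

lemma measurable_bundle {b : α → Fin n → Fin m → Fin r → ℝ}
    (hb : ∀ i j t, Measurable fun x => b x i j t) (σ : Fin m → Equiv.Perm (Fin n)) (i : Fin n) :
    Measurable fun x => bundle k (b x) σ i :=
  measurable_pi_lambda _ fun j => measurable_ncard fun t =>
    measurableSet_wins (a := fun x l => b x l j) (fun i t => hb i j t) (k j) (σ j) (i, t)

lemma measurable_payment {b : α → Fin n → Fin m → Fin r → ℝ}
    (hb : ∀ i j t, Measurable fun x => b x i j t) (σ : Fin m → Equiv.Perm (Fin n)) (i : Fin n) :
    Measurable fun x => payment k (b x) σ i := by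
  refine Finset.measurable_sum _ fun j _ => Measurable.mul ?_
    (measurable_price (a := fun x l => b x l j) (fun i t => hb i j t) (k j) (σ j))
  have h1 : Measurable fun c : ℕ => (c : ℝ) := measurable_from_top
  exact h1.comp ((measurable_pi_apply j).comp (measurable_bundle hb σ i))

lemma measurable_arriving {s : α → Fin n → Bid m r B} (hs : Measurable s) (z : Fin n → Bool)
    (i : Fin n) (j : Fin m) (t : Fin r) : Measurable fun x => arriving (s x) z i j t := by
  unfold arriving
  by_cases hz : z i = true
  · simp only [hz, if_true]
    have h1 : Measurable fun x => (s x i).1 :=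
      measurable_subtype_coe.comp ((measurable_pi_apply i).comp hs)
    exact (measurable_pi_apply t).comp ((measurable_pi_apply j).comp h1)
  · simp [hz]

lemma measurable_valuation_apply {w : α → Val m} (hw : Measurable w) {y : α → Fin m → ℕ}
    (hy : Measurable y) : Measurable fun x => w x (y x) := by
  have h1 : Measurable fun q : Val m × (Fin m → ℕ) => q.1 q.2 :=
    measurable_from_prod_countable_left fun y => measurable_pi_apply y
  exact h1.comp (hw.prodMk hy)

lemma measurable_arrivalExp {f : α → (Fin n → Bool) → ℝ} (hf : ∀ z, Measurable fun x => f x z) :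
    Measurable fun x => arrivalExp δ (f x) :=
  Finset.measurable_sum _ fun z _ => (hf z).const_mul _

lemma measurable_tieExp {f : α → (Fin m → Equiv.Perm (Fin n)) → ℝ}
    (hf : ∀ σ, Measurable fun x => f x σ) : Measurable fun x => tieExp (f x) :=
  (Finset.measurable_sum _ fun σ _ => hf σ).div_const _

lemma measurable_utility {s : α → Fin n → Bid m r B} (hs : Measurable s) {w : α → Val m}
    (hw : Measurable w) (i : Fin n) : Measurable fun x => utility k δ (s x) i (w x) := by
  refine measurable_arrivalExp fun z => ?_
  by_cases hz : z i = true
  · simp only [hz, if_true]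
    exact measurable_tieExp fun σ => (measurable_valuation_apply hw
      (measurable_bundle (measurable_arriving hs z) σ i)).sub
      (measurable_payment (measurable_arriving hs z) σ i)
  · simp [hz]

lemma measurable_revenue {s : α → Fin n → Bid m r B} (hs : Measurable s) :
    Measurable fun x => revenue k δ (s x) :=
  measurable_arrivalExp fun z => measurable_tieExp fun σ => Finset.measurable_sum _ fun i _ =>
    measurable_payment (measurable_arriving hs z) σ i

lemma measurable_optWelfare {u : α → Fin n → Val m} (hu : ∀ i, Measurable fun x => u x i) :
    Measurable fun x => optWelfare k (u x) := by
  have h1 : ∀ x, optWelfare k (u x) =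
      ⨆ y : {y : Fin n → Fin m → ℕ // ∀ j, ∑ i, y i j ≤ k j}, ∑ i, u x i (y.1 i) := by
    intro x
    rw [optWelfare, iSup]
    congr 1
    ext w
    constructor
    · rintro ⟨y, hy, rfl⟩
      exact ⟨⟨y, hy⟩, rfl⟩
    · rintro ⟨y, rfl⟩
      exact ⟨y.1, y.2, rfl⟩
  simp only [h1]
  exact Measurable.iSup fun y => Finset.measurable_sum _ fun i _ =>
    (measurable_pi_apply (y.1 i)).comp (hu i)

lemma measurable_expOpt : Measurable fun v : Fin n → Val m => expOpt k δ v := by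
  refine measurable_arrivalExp fun z => measurable_optWelfare fun i => ?_
  by_cases hz : z i = true
  · simp only [hz, if_true]
    exact measurable_pi_apply i
  · simp [hz]

end Measurability

/-! ### Bounds on outcomes -/

section Bounds

variable {n m r : ℕ} {k : Fin m → ℕ} {H B ρ δ : ℝ}

lemma bundle_le (b : Fin n → Fin m → Fin r → ℝ) (σ : Fin m → Equiv.Perm (Fin n)) (i : Fin n)
    (j : Fin m) : bundle k b σ i j ≤ r := by
  calc bundle k b σ i j ≤ Set.ncard (Set.univ : Set (Fin r)) :=
        Set.ncard_le_ncard (Set.subset_univ _) (Set.toFinite _)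
    _ = r := by simp [Set.ncard_univ]

lemma price_arriving_nonneg (s : Fin n → Bid m r B) (z : Fin n → Bool) (K : ℕ) (j : Fin m)
    (σ : Equiv.Perm (Fin n)) : 0 ≤ price K (fun l => arriving s z l j) σ :=
  price_nonneg (a := fun l => arriving s z l j) (fun i t => arriving_nonneg s z i j t) K σ

lemma payment_nonneg (s : Fin n → Bid m r B) (z : Fin n → Bool)
    (σ : Fin m → Equiv.Perm (Fin n)) (i : Fin n) : 0 ≤ payment k (arriving s z) σ i :=
  Finset.sum_nonneg fun j _ => mul_nonneg (Nat.cast_nonneg _)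
    (price_arriving_nonneg s z (k j) j (σ j))

lemma payment_le (s : Fin n → Bid m r B) (z : Fin n → Bool)
    (σ : Fin m → Equiv.Perm (Fin n)) (i : Fin n) :
    payment k (arriving s z) σ i ≤ m * (r * |B|) := by
  have hprice : ∀ j, price (k j) (fun l => arriving s z l j) (σ j) ≤ |B| := by
    intro j
    refine price_le (abs_nonneg B) (fun l t => ?_) _ _
    rw [arriving]
    split_ifs
    · exact (bid_le _ _ _).trans (le_abs_self B)
    · exact abs_nonneg B
  calc payment k (arriving s z) σ i ≤ ∑ _j : Fin m, (r : ℝ) * |B| := by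
        refine Finset.sum_le_sum fun j _ => ?_
        have hb : (bundle k (arriving s z) σ i j : ℝ) ≤ r := 
          Nat.cast_le.2 (bundle_le (k := k) (arriving s z) σ i j)
        exact mul_le_mul hb (hprice j) (price_arriving_nonneg s z (k j) j (σ j)) (Nat.cast_nonneg r)
    _ = _ := by simp

lemma payment_eq_zero (s : Fin n → Bid m r B) {z : Fin n → Bool}
    (σ : Fin m → Equiv.Perm (Fin n)) {i : Fin n} (hz : ¬ z i = true) :
    payment k (arriving s z) σ i = 0 := by
  refine Finset.sum_eq_zero fun j _ => ?_
  have hzero : ∀ t, arriving s z i j t = 0 := fun t => by simp [arriving, hz]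
  exact ncard_mul_price_eq_zero (a := fun l => arriving s z l j)
    (fun l t => arriving_nonneg s z l j t) (k j) (σ j) hzero

lemma abs_utility_le (h0 : 0 ≤ δ) (h1 : δ ≤ 1) (s : Fin n → Bid m r B) (i : Fin n) {w : Val m}
    (hw : w ∈ valuations m r H ρ) : |utility k δ s i w| ≤ |H| + m * (r * |B|) := by
  refine abs_arrivalExp_le h0 h1 fun z => ?_
  split_ifs
  · refine abs_tieExp_le fun σ => ?_
    have e1 := hw.2.1 (bundle k (arriving s z) σ i)
    have e2 := payment_nonneg (k := k) s z σ i
    have e3 := payment_le (k := k) s z σ i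
    rw [abs_le]
    constructor <;> linarith [le_abs_self H, abs_nonneg H]
  · rw [abs_zero]
    positivity

lemma abs_revenue_le (h0 : 0 ≤ δ) (h1 : δ ≤ 1) (s : Fin n → Bid m r B) :
    |revenue k δ s| ≤ n * (m * (r * |B|)) := by
  refine abs_arrivalExp_le h0 h1 fun z => abs_tieExp_le fun σ => ?_
  refine (Finset.abs_sum_le_sum_abs _ _).trans ?_
  calc _ ≤ ∑ _i : Fin n, (m : ℝ) * (r * |B|) := by
        refine Finset.sum_le_sum fun i _ => ?_
        rw [abs_of_nonneg (payment_nonneg s z σ i)]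
        exact payment_le s z σ i
    _ = _ := by simp

lemma welfare_nonneg (h0 : 0 ≤ δ) (h1 : δ ≤ 1) (s : Fin n → Bid m r B) {v : Fin n → Val m}
    (hv : ∀ i, v i ∈ valuations m r H ρ) : 0 ≤ welfare k δ s v := by
  refine arrivalExp_nonneg h0 h1 fun z => ?_
  refine (tieExp_const (n := n) (m := m) 0).symm.trans_le (tieExp_mono fun σ => ?_)
  refine Finset.sum_nonneg fun i _ => ?_
  split_ifs
  · exact ((hv i).2.1 _).1
  · exact le_rfl

lemma expOpt_nonneg (h0 : 0 ≤ δ) (h1 : δ ≤ 1) {v : Fin n → Val m}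
    (hv : ∀ i, v i ∈ valuations m r H ρ) : 0 ≤ expOpt k δ v := by
  refine arrivalExp_nonneg h0 h1 fun z => ?_
  obtain ⟨x, -, -, he⟩ := exists_optimal_allocation (k := k) hv z
  rw [he]
  refine Finset.sum_nonneg fun i _ => ?_
  split_ifs
  · exact ((hv i).2.1 _).1
  · exact le_rfl

lemma abs_expOpt_le (h0 : 0 ≤ δ) (h1 : δ ≤ 1) {v : Fin n → Val m}
    (hv : ∀ i, v i ∈ valuations m r H ρ) : |expOpt k δ v| ≤ n * |H| := by
  refine abs_arrivalExp_le h0 h1 fun z => ?_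
  obtain ⟨x, -, -, he⟩ := exists_optimal_allocation (k := k) hv z
  rw [he]
  refine (Finset.abs_sum_le_sum_abs _ _).trans ?_
  calc _ ≤ ∑ _i : Fin n, |H| := by
        refine Finset.sum_le_sum fun i _ => ?_
        have e1 := (hv i).2.1 (x i)
        split_ifs
        · rw [abs_of_nonneg e1.1]
          exact e1.2.trans (le_abs_self H)
        · rw [abs_zero]
          exact abs_nonneg H
    _ = _ := by simp

/-- Payments are transfers: bidders who do not arrive pay nothing. -/
lemma sum_utility_add_revenue (s : Fin n → Bid m r B) (v : Fin n → Val m) :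
    ∑ i, utility k δ s i (v i) + revenue k δ s = welfare k δ s v := by
  simp only [utility, revenue, welfare, ← arrivalExp_sum, ← arrivalExp_add]
  congr 1
  ext z
  have h1 : ∀ i, (if z i then tieExp fun σ =>
      v i (bundle k (arriving s z) σ i) - payment k (arriving s z) σ i else 0) =
      tieExp fun σ => (if z i then v i (bundle k (arriving s z) σ i) else 0) -
        payment k (arriving s z) σ i := by
    intro i
    by_cases hz : z i = true
    · simp [hz]
    · simp [hz, payment_eq_zero s _ hz, tieExp_const]
  simp only [h1, ← tieExp_sum, ← tieExp_add]
  congr 1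
  ext σ
  rw [Finset.sum_sub_distrib]
  ring

end Bounds

/-! ### From deviations to smoothness and equilibria -/

section Equilibria

variable {n m r : ℕ} {k : Fin m → ℕ} {H B ρ δ lam : ℝ}

/-- The smoothness inequality with parameters `(lam, 1)` for deviations that are functions of
independently sampled arrivals. -/
def HasDeviations (n : ℕ) {m : ℕ} (r : ℕ) (k : Fin m → ℕ) (H B ρ δ lam : ℝ) : Prop :=
  ∀ v : Fin n → Val m, (∀ i, v i ∈ valuations m r H ρ) →
    ∃ d : Fin n → (Fin n → Bool) → Bid m r B, ∀ s : Fin n → Bid m r B,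
      lam * expOpt k δ v - revenue k δ s ≤
        ∑ i, arrivalExp δ fun z => utility k δ (Function.update s i (d i z)) i (v i)

lemma HasDeviations.isSmooth (h0 : 0 ≤ δ) (h1 : δ ≤ 1) (h : HasDeviations n r k H B ρ δ lam) :
    IsSmooth n r k H B ρ δ lam 1 := by
  intro v hv
  obtain ⟨d, hd⟩ := h v hv
  refine ⟨fun i => ∑ z, ENNReal.ofReal (∏ l, if z l then 1 - δ else δ) • Measure.dirac (d i z),
    fun i => ⟨?_⟩, fun s => ?_⟩
  · have h2 : ∑ z : Fin n → Bool, ∏ l, (if z l then 1 - δ else δ) = 1 := by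
      have := arrivalExp_const (n := n) (δ := δ) 1
      simpa [arrivalExp] using this
    simp only [Measure.finsetSum_apply, Measure.smul_apply, measure_univ, smul_eq_mul, mul_one]
    rw [← ENNReal.ofReal_sum_of_nonneg fun z _ => arrivalWeight_nonneg h0 h1 z, h2,
      ENNReal.ofReal_one]
  · rw [one_mul]
    refine (hd s).trans_eq (Finset.sum_congr rfl fun i _ => ?_)
    rw [integral_finsetSum_measure]
    · refine Finset.sum_congr rfl fun z _ => ?_
      rw [integral_smul_measure, integral_dirac,
        ENNReal.toReal_ofReal (arrivalWeight_nonneg h0 h1 z), smul_eq_mul]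
    · intro z _
      exact (integrable_dirac (by simp)).smul_measure ENNReal.ofReal_ne_top

lemma robustPoA_le_of_isSmooth (hlam : 0 < lam) (h : IsSmooth n r k H B ρ δ lam 1) :
    robustPoA n r k H B ρ δ ≤ ENNReal.ofReal (1 / lam) :=
  sInf_le ⟨lam, 1, hlam, zero_le_one, h, by simp⟩

lemma integral_arrivalExp {α : Type*} [MeasurableSpace α] {μ : Measure α}
    {f : α → (Fin n → Bool) → ℝ} (hf : ∀ z, Integrable (fun x => f x z) μ) :
    ∫ x, arrivalExp δ (f x) ∂μ = arrivalExp δ fun z => ∫ x, f x z ∂μ := by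
  simp only [arrivalExp]
  rw [integral_finsetSum _ fun z _ => (hf z).const_mul _]
  simp only [integral_const_mul]

lemma integrable_utility {α : Type*} [MeasurableSpace α] {μ : Measure α} [IsFiniteMeasure μ]
    (h0 : 0 ≤ δ) (h1 : δ ≤ 1) {s : α → Fin n → Bid m r B} (hs : Measurable s) {w : α → Val m}
    (hw : Measurable w) (hval : ∀ᵐ x ∂μ, w x ∈ valuations m r H ρ) (i : Fin n) :
    Integrable (fun x => utility k δ (s x) i (w x)) μ := by
  refine Integrable.of_bound (measurable_utility hs hw i).aestronglyMeasurable
    (|H| + m * (r * |B|)) ?_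
  filter_upwards [hval] with x hx
  exact abs_utility_le h0 h1 _ _ hx

lemma integrable_revenue {α : Type*} [MeasurableSpace α] {μ : Measure α} [IsFiniteMeasure μ]
    (h0 : 0 ≤ δ) (h1 : δ ≤ 1) {s : α → Fin n → Bid m r B} (hs : Measurable s) :
    Integrable (fun x => revenue k δ (s x)) μ :=
  Integrable.of_bound (measurable_revenue hs).aestronglyMeasurable _
    (ae_of_all _ fun _ => abs_revenue_le h0 h1 _)

/-- The smoothness inequality averaged over the law of the bids. -/
lemma integral_deviations_ge {α : Type*} [MeasurableSpace α] {μ : Measure α}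
    [IsProbabilityMeasure μ] (h0 : 0 ≤ δ) (h1 : δ ≤ 1) {s : α → Fin n → Bid m r B}
    (hs : Measurable s) {v : Fin n → Val m} (hv : ∀ i, v i ∈ valuations m r H ρ)
    {d : Fin n → (Fin n → Bool) → Bid m r B}
    (hd : ∀ s : Fin n → Bid m r B, lam * expOpt k δ v - revenue k δ s ≤
      ∑ i, arrivalExp δ fun z => utility k δ (Function.update s i (d i z)) i (v i))
    {V : Fin n → ℝ}
    (hV : ∀ i t, ∫ x, utility k δ (Function.update (s x) i t) i (v i) ∂μ ≤ V i) :
    lam * expOpt k δ v - ∫ x, revenue k δ (s x) ∂μ ≤ ∑ i, V i := by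
  have hint : ∀ i t, Integrable
      (fun x => utility k δ (Function.update (s x) i t) i (v i)) μ := fun i t =>
    integrable_utility h0 h1 ((measurable_update' (a := i)).comp (hs.prodMk measurable_const))
      measurable_const (ae_of_all _ fun _ => hv i) i
  have hintE : ∀ i, Integrable (fun x => arrivalExp δ fun z =>
      utility k δ (Function.update (s x) i (d i z)) i (v i)) μ := fun i =>
    integrable_finsetSum _ fun z _ => (hint i (d i z)).const_mul _
  calc lam * expOpt k δ v - ∫ x, revenue k δ (s x) ∂μ
      = ∫ x, (lam * expOpt k δ v - revenue k δ (s x)) ∂μ := by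
        rw [integral_sub (integrable_const _) (integrable_revenue h0 h1 hs)]
        simp
    _ ≤ ∫ x, ∑ i, arrivalExp δ (fun z =>
          utility k δ (Function.update (s x) i (d i z)) i (v i)) ∂μ :=
        integral_mono ((integrable_const _).sub (integrable_revenue h0 h1 hs))
          (integrable_finsetSum _ fun i _ => hintE i) fun x => hd (s x)
    _ = ∑ i, arrivalExp δ fun z =>
          ∫ x, utility k δ (Function.update (s x) i (d i z)) i (v i) ∂μ := by
        rw [integral_finsetSum _ fun i _ => hintE i]
        exact Finset.sum_congr rfl fun i _ => integral_arrivalExp fun z => hint i (d i z)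
    _ ≤ ∑ i, V i := by
        refine Finset.sum_le_sum fun i _ => ?_
        rw [← arrivalExp_const (n := n) (δ := δ) (V i)]
        exact arrivalExp_mono h0 h1 fun z => hV i _

/-- Resampling one coordinate of a product of probability measures does not change the law. -/
lemma measurePreserving_update {ι : Type*} [Fintype ι] [DecidableEq ι] {X : ι → Type*}
    [∀ i, MeasurableSpace (X i)] (ν : ∀ i, Measure (X i)) [∀ i, IsProbabilityMeasure (ν i)]
    (i : ι) : MeasurePreserving (fun q : X i × (∀ l, X l) => Function.update q.2 i q.1)
      ((ν i).prod (Measure.pi ν)) (Measure.pi ν) := by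
  have hmeas : Measurable (fun q : X i × (∀ l, X l) => Function.update q.2 i q.1) :=
    measurable_update'.comp measurable_swap
  refine ⟨hmeas, (Measure.pi_eq fun A hA => ?_).symm⟩
  rw [Measure.map_apply hmeas (MeasurableSet.univ_pi hA)]
  have hpre : (fun q : X i × (∀ l, X l) => Function.update q.2 i q.1) ⁻¹' (Set.univ.pi A) =
      A i ×ˢ (Set.univ.pi (Function.update A i Set.univ)) := by
    ext q
    simp only [Set.mem_preimage, Set.mem_univ_pi, Set.mem_prod]
    constructor
    · intro h
      refine ⟨by simpa using h i, fun l => ?_⟩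
      by_cases hl : l = i
      · subst hl; simp
      · simpa [hl] using h l
    · rintro ⟨h2, h3⟩ l
      by_cases hl : l = i
      · subst hl; simpa using h2
      · simpa [hl] using h3 l
  rw [hpre, Measure.prod_prod, Measure.pi_pi, ← Finset.mul_prod_erase _ _ (Finset.mem_univ i),
    ← Finset.mul_prod_erase Finset.univ (fun l => ν l (A l)) (Finset.mem_univ i)]
  simp only [Function.update_self, measure_univ, one_mul]
  congr 1
  refine Finset.prod_congr rfl fun l hl => ?_
  rw [Function.update_of_ne (Finset.ne_of_mem_erase hl)]

lemma HasDeviations.le_of_isCCE (h0 : 0 ≤ δ) (h1 : δ ≤ 1)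
    (h : HasDeviations n r k H B ρ δ lam) {v : Fin n → Val m}
    (hv : ∀ i, v i ∈ valuations m r H ρ) {D : Measure (Fin n → Bid m r B)}
    [IsProbabilityMeasure D] (hD : IsCCE k δ v D) :
    lam * expOpt k δ v ≤ ∫ s, welfare k δ s v ∂D := by
  obtain ⟨d, hd⟩ := h v hv
  have h2 := integral_deviations_ge (μ := D) h0 h1 measurable_id hv hd hD
  have hint : ∀ i, Integrable (fun s => utility k δ s i (v i)) D := fun i =>
    integrable_utility h0 h1 measurable_id measurable_const (ae_of_all _ fun _ => hv i) i
  have hrev : Integrable (fun s : Fin n → Bid m r B => revenue k δ s) D :=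
    integrable_revenue h0 h1 measurable_id
  have h3 : ∫ s, welfare k δ s v ∂D =
      ∑ i, ∫ s, utility k δ s i (v i) ∂D + ∫ s, revenue k δ s ∂D := by
    simp only [← sum_utility_add_revenue]
    rw [integral_add (integrable_finsetSum _ fun i _ => hint i) hrev,
      integral_finsetSum _ fun i _ => hint i]
  simp only [id] at h2
  linarith

section Bayes

variable {F : Fin n → Measure (Val m)} [∀ i, IsProbabilityMeasure (F i)]
  {β : Fin n → Kernel (Val m) (Bid m r B)} [∀ i, IsMarkovKernel (β i)]

instance : IsProbabilityMeasure (playLaw F β) := by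
  unfold playLaw
  infer_instance

lemma ae_compProd_mem_valuations (hF : ∀ i, ∀ᵐ w ∂(F i), w ∈ valuations m r H ρ) (i : Fin n) :
    ∀ᵐ q ∂(F i ⊗ₘ β i), q.1 ∈ valuations m r H ρ := by
  have h1 := hF i
  rw [← Measure.fst_compProd (F i) (β i)] at h1
  exact ae_of_ae_map measurable_fst.aemeasurable h1

lemma ae_playLaw_mem_valuations (hF : ∀ i, ∀ᵐ w ∂(F i), w ∈ valuations m r H ρ) :
    ∀ᵐ p ∂(playLaw F β), ∀ i, (p i).1 ∈ valuations m r H ρ := by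
  rw [ae_all_iff]
  intro i
  exact (Measure.quasiMeasurePreserving_eval (fun i => F i ⊗ₘ β i) i).ae
    (ae_compProd_mem_valuations hF i)

lemma measurable_bids : Measurable fun (p : Fin n → Val m × Bid m r B) l => (p l).2 :=
  measurable_pi_lambda _ fun l => measurable_snd.comp (measurable_pi_apply l)

/-- The interim payoff of bidder `i` in the Bayesian game, when her valuation is `w` and she
follows her own strategy. -/
noncomputable def interimUtility (k : Fin m → ℕ) (δ : ℝ) (F : Fin n → Measure (Val m))
    (β : Fin n → Kernel (Val m) (Bid m r B)) (i : Fin n) (w : Val m) : ℝ :=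
  ∫ t, ∫ p, utility k δ (Function.update (fun l => (p l).2) i t) i w ∂(playLaw F β) ∂(β i w)

lemma integrable_interimUtility_and_integral_eq (h0 : 0 ≤ δ) (h1 : δ ≤ 1)
    (hF : ∀ i, ∀ᵐ w ∂(F i), w ∈ valuations m r H ρ) (i : Fin n) :
    Integrable (interimUtility k δ F β i) (F i) ∧
      ∫ w, interimUtility k δ F β i w ∂(F i) =
        ∫ p, utility k δ (fun l => (p l).2) i (p i).1 ∂(playLaw F β) := by
  have hmp := measurePreserving_update (fun i => F i ⊗ₘ β i) i
  change MeasurePreserving _ (Measure.prod _ (playLaw F β)) (playLaw F β) at hmp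
  have hg : Measurable fun p : Fin n → Val m × Bid m r B =>
      utility k δ (fun l => (p l).2) i (p i).1 :=
    measurable_utility measurable_bids (measurable_fst.comp (measurable_pi_apply i)) i
  have hgint : Integrable (fun p : Fin n → Val m × Bid m r B =>
      utility k δ (fun l => (p l).2) i (p i).1) (playLaw F β) := by
    refine integrable_utility h0 h1 measurable_bids (measurable_fst.comp (measurable_pi_apply i))
      ?_ i (H := H) (ρ := ρ)
    filter_upwards [ae_playLaw_mem_valuations (β := β) hF] with p hp using hp i
  have hcomp : ∀ q : (Val m × Bid m r B) × (Fin n → Val m × Bid m r B),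
      utility k δ (fun l => (Function.update q.2 i q.1 l).2) i (Function.update q.2 i q.1 i).1 =
      utility k δ (Function.update (fun l => (q.2 l).2) i q.1.2) i q.1.1 := by
    intro q
    congr 1
    · ext l : 1
      by_cases hl : l = i
      · subst hl; simp
      · simp [hl]
    · simp
  have hfint := hmp.integrable_comp_of_integrable hgint
  simp only [Function.comp_def, hcomp] at hfint
  have hfint' := hfint.integral_prod_left
  refine ⟨Integrable.integral_compProd (a := ()) (κ := Kernel.const Unit (F i))
    (η := Kernel.prodMkLeft Unit (β i)) hfint', ?_⟩
  have hchange : ∫ p, utility k δ (fun l => (p l).2) i (p i).1 ∂(playLaw F β) =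
      ∫ q, utility k δ (Function.update (fun l => (q.2 l).2) i q.1.2) i q.1.1
        ∂((F i ⊗ₘ β i).prod (playLaw F β)) := by
    rw [← hmp.map_eq, integral_map hmp.measurable.aemeasurable hg.aestronglyMeasurable, hmp.map_eq]
    simp only [hcomp]
  rw [hchange, integral_prod _ hfint, Measure.integral_compProd hfint']
  rfl

lemma HasDeviations.le_of_isBNE (h0 : 0 ≤ δ) (h1 : δ ≤ 1)
    (h : HasDeviations n r k H B ρ δ lam) (hF : ∀ i, ∀ᵐ w ∂(F i), w ∈ valuations m r H ρ)
    (hβ : IsBNE k δ F β) :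
    lam * ∫ v, expOpt k δ v ∂(Measure.pi F) ≤
      ∫ p, welfare k δ (fun i => (p i).2) (fun i => (p i).1) ∂(playLaw F β) := by
  set R := ∫ p, revenue k δ (fun l => (p l).2) ∂(playLaw F β) with hR
  have hval : ∀ᵐ v ∂(Measure.pi F), ∀ i, v i ∈ valuations m r H ρ := by
    rw [ae_all_iff]
    exact fun i => (Measure.quasiMeasurePreserving_eval F i).ae (hF i)
  have hbne : ∀ᵐ v ∂(Measure.pi F), ∀ i, ∀ t : Bid m r B,
      ∫ p, utility k δ (Function.update (fun l => (p l).2) i t) i (v i) ∂(playLaw F β) ≤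
        interimUtility k δ F β i (v i) := by
    rw [ae_all_iff]
    exact fun i => (Measure.quasiMeasurePreserving_eval F i).ae (hβ i)
  -- For almost every valuation profile, the deviation may depend on the whole profile: against the
  -- independent bids of the others it is an ordinary deviation for each type.
  have hpoint : ∀ᵐ v ∂(Measure.pi F),
      lam * expOpt k δ v - R ≤ ∑ i, interimUtility k δ F β i (v i) := by
    filter_upwards [hval, hbne] with v hv hb
    obtain ⟨d, hd⟩ := h v hv
    exact integral_deviations_ge h0 h1 measurable_bids hv hd hb
  have hoptint : Integrable (fun v => expOpt k δ v) (Measure.pi F) := by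
    refine Integrable.of_bound measurable_expOpt.aestronglyMeasurable (n * |H|) ?_
    filter_upwards [hval] with v hv
    exact abs_expOpt_le h0 h1 hv
  have hVint : ∀ i, Integrable (fun v : Fin n → Val m => interimUtility k δ F β i (v i))
      (Measure.pi F) := fun i =>
    (measurePreserving_eval F i).integrable_comp_of_integrable
      (integrable_interimUtility_and_integral_eq h0 h1 hF i).1
  have hVeq : ∀ i, ∫ v, interimUtility k δ F β i (v i) ∂(Measure.pi F) =
      ∫ p, utility k δ (fun l => (p l).2) i (p i).1 ∂(playLaw F β) := by
    intro i
    obtain ⟨k1, k2⟩ := integrable_interimUtility_and_integral_eq (k := k) (β := β) h0 h1 hF i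
    rw [← k2]
    have hmp := measurePreserving_eval F i
    have k3 := k1.aestronglyMeasurable
    rw [← hmp.map_eq] at k3
    have := integral_map hmp.measurable.aemeasurable k3
    rw [hmp.map_eq] at this
    exact this.symm
  have hmono := integral_mono_ae ((hoptint.const_mul lam).sub (integrable_const R))
    (integrable_finsetSum _ fun i _ => hVint i) hpoint
  have hgint : ∀ i, Integrable (fun p : Fin n → Val m × Bid m r B =>
      utility k δ (fun l => (p l).2) i (p i).1) (playLaw F β) := by
    intro i
    refine integrable_utility h0 h1 measurable_bids (measurable_fst.comp (measurable_pi_apply i))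
      ?_ i (H := H) (ρ := ρ)
    filter_upwards [ae_playLaw_mem_valuations (β := β) hF] with p hp using hp i
  have hwel : ∫ p, welfare k δ (fun i => (p i).2) (fun i => (p i).1) ∂(playLaw F β) =
      ∑ i, ∫ p, utility k δ (fun l => (p l).2) i (p i).1 ∂(playLaw F β) + R := by
    simp only [← sum_utility_add_revenue]
    rw [integral_add (integrable_finsetSum _ fun i _ => hgint i)
      (integrable_revenue h0 h1 measurable_bids), integral_finsetSum _ fun i _ => hgint i]
  simp only [Pi.sub_apply] at hmono
  rw [integral_sub (hoptint.const_mul lam) (integrable_const R), integral_const_mul,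
    integral_finsetSum _ fun i _ => hVint i, Finset.sum_congr rfl fun i _ => hVeq i] at hmono
  simp at hmono
  linarith

end Bayes

lemma HasDeviations.equilibriaAchieve (h0 : 0 ≤ δ) (h1 : δ ≤ 1)
    (h : HasDeviations n r k H B ρ δ lam) : EquilibriaAchieve n r k H B ρ δ lam :=
  ⟨fun _ hv _ _ hD => h.le_of_isCCE h0 h1 hv hD, fun _ _ hF _ _ hβ => h.le_of_isBNE h0 h1 hF hβ⟩

lemma equilibriaAchieve_of_nonpos (h0 : 0 ≤ δ) (h1 : δ ≤ 1) (hlam : lam ≤ 0) :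
    EquilibriaAchieve n r k H B ρ δ lam := by
  refine ⟨fun v hv D _ _ => ?_, fun F _ hF β _ _ => ?_⟩
  · exact (mul_nonpos_of_nonpos_of_nonneg hlam (expOpt_nonneg h0 h1 hv)).trans
      (integral_nonneg fun s => welfare_nonneg h0 h1 s hv)
  · refine (mul_nonpos_of_nonpos_of_nonneg hlam (integral_nonneg_of_ae ?_)).trans
      (integral_nonneg_of_ae ?_)
    · have hval : ∀ᵐ v ∂(Measure.pi F), ∀ i, v i ∈ valuations m r H ρ := by
        rw [ae_all_iff]
        exact fun i => (Measure.quasiMeasurePreserving_eval F i).ae (hF i)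
      filter_upwards [hval] with v hv using expOpt_nonneg h0 h1 hv
    · filter_upwards [ae_playLaw_mem_valuations (β := β) hF] with p hp
      exact welfare_nonneg h0 h1 _ hp

end Equilibria

/-! ### Supply conditions -/

section Supply

variable {m r : ℕ} {H B ρ δ ε : ℝ}

lemma hasDeviations_of_supply (hr : 0 < r) (hρ : 0 < ρ) (hHB : H ≤ B) (h0 : 0 < δ) (h1 : δ < 1)
    (n : ℕ) (k : Fin m → ℕ) (hε : 0 < ε)
    (hk : ∀ j, 16 * (m : ℝ) ^ 2 * (B + H) ^ 2 * (r : ℝ) ^ 8 /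
      (ε ^ 2 * ρ ^ 2 * (δ * (1 - δ))) + r ≤ k j) :
    HasDeviations n r k H B ρ δ (1 - ε) := by
  refine fun v hv => exists_deviation hr h0 h1 hρ hHB hε (fun hρH j => ?_) hv
  have hc : 0 < δ * (1 - δ) := mul_pos h0 (by linarith)
  have hX : 0 < ε ^ 2 * ρ ^ 2 * (δ * (1 - δ)) := by positivity
  have hj := hk j
  have hdiv : 0 ≤ 16 * (m : ℝ) ^ 2 * (B + H) ^ 2 * (r : ℝ) ^ 8 /
      (ε ^ 2 * ρ ^ 2 * (δ * (1 - δ))) := by positivity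
  refine ⟨by exact_mod_cast (by linarith : (r : ℝ) ≤ k j), ?_⟩
  have h2 : 16 * (m : ℝ) ^ 2 * (B + H) ^ 2 * (r : ℝ) ^ 8 ≤
      (k j - r) * (ε ^ 2 * ρ ^ 2 * (δ * (1 - δ))) := by
    rw [← div_le_iff₀ hX]
    linarith
  have hr1 : (1 : ℝ) ≤ r := by exact_mod_cast hr
  have h3 : (r : ℝ) ^ 5 ≤ (r : ℝ) ^ 8 := pow_le_pow_right₀ hr1 (by norm_num)
  have h4 : B ^ 2 ≤ (B + H) ^ 2 := pow_le_pow_left₀ (by linarith) (by linarith) 2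
  calc 4 * (m : ℝ) ^ 2 * B ^ 2 * (r : ℝ) ^ 5
      ≤ 16 * (m : ℝ) ^ 2 * (B + H) ^ 2 * (r : ℝ) ^ 8 := by gcongr; norm_num
    _ ≤ _ := h2
    _ ≤ _ := by linarith

lemma hasDeviations_of_supply_unit (hρ : 0 < ρ) (hHB : H ≤ B) (h0 : 0 < δ) (h1 : δ < 1)
    (n : ℕ) (k : Fin m → ℕ) (hε : 0 < ε)
    (hk : ∀ j, 36 * (m : ℝ) ^ 2 * (B + H) ^ 2 / (ε ^ 2 * ρ ^ 2 * (δ * (1 - δ))) ≤ k j) :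
    HasDeviations n 1 k H B ρ δ (1 - ε) := by
  refine fun v hv => exists_deviation one_pos h0 h1 hρ hHB hε (fun hρH j => ?_) hv
  have hc : 0 < δ * (1 - δ) := mul_pos h0 (by linarith)
  have hX : 0 < ε ^ 2 * ρ ^ 2 * (δ * (1 - δ)) := by positivity
  have hm : (0 : ℝ) < m := by exact_mod_cast j.pos
  have hBH : 0 < B + H := by linarith
  have hj := hk j
  have hdiv : 0 < 36 * (m : ℝ) ^ 2 * (B + H) ^ 2 / (ε ^ 2 * ρ ^ 2 * (δ * (1 - δ))) := by
    positivity
  refine ⟨by exact_mod_cast hdiv.trans_le hj, ?_⟩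
  rw [div_le_iff₀ hX] at hj
  have h4 : B ^ 2 ≤ (B + H) ^ 2 := pow_le_pow_left₀ (by linarith) (by linarith) 2
  calc 4 * (m : ℝ) ^ 2 * B ^ 2 * ((1 : ℕ) : ℝ) ^ 5
      = 4 * (m : ℝ) ^ 2 * B ^ 2 := by simp
    _ ≤ 36 * (m : ℝ) ^ 2 * (B + H) ^ 2 := by gcongr; norm_num
    _ ≤ _ := hj
    _ = _ := by push_cast; ring

lemma equilibriaAchieve_of_linear_supply (hr : 0 < r) (hρ : 0 < ρ) (hHB : H ≤ B) (h0 : 0 < δ)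
    (h1 : δ < 1) {c : ℝ} (hc : 0 < c) :
    ∃ C : ℝ, ∀ n : ℕ, 0 < n → ∀ k : Fin m → ℕ, (∀ j, c * (n : ℝ) ≤ k j) →
      EquilibriaAchieve n r k H B ρ δ (1 - C / √(n : ℝ)) := by
  have hδ : 0 < δ * (1 - δ) := mul_pos h0 (by linarith)
  have hr' : (0 : ℝ) < r := by exact_mod_cast hr
  set A := 16 * (m : ℝ) ^ 2 * (B + H) ^ 2 * (r : ℝ) ^ 8 / (ρ ^ 2 * (δ * (1 - δ))) with hA
  have hA0 : 0 ≤ A := by positivity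
  -- With `C ^ 2 = 2 * (A + r) / c`, the supply needed for `ε = C / √n` is `A * n / C ^ 2 + r`. Each
  -- of the two terms is at most `c * n / 2`, the second one because `r ≤ c * n / 2` if `C < √n`.
  set C := √(2 * (A + r) / c) with hC
  have hC2 : C ^ 2 = 2 * (A + r) / c := Real.sq_sqrt (by positivity)
  have hC0 : 0 < C := Real.sqrt_pos.2 (by positivity)
  refine ⟨C, fun n hn k hk => ?_⟩
  have hn' : (0 : ℝ) < n := by exact_mod_cast hn
  have hsn : 0 < √(n : ℝ) := Real.sqrt_pos.2 hn'
  by_cases hCn : √(n : ℝ) ≤ C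
  · refine equilibriaAchieve_of_nonpos h0.le h1.le ?_
    have : 1 ≤ C / √(n : ℝ) := (one_le_div hsn).2 hCn
    linarith
  · have hlt : C ^ 2 < n := by
      rw [← Real.sq_sqrt hn'.le]
      exact pow_lt_pow_left₀ (not_le.1 hCn) hC0.le two_ne_zero
    have hcn : 2 * (A + r) < n * c := by rwa [hC2, div_lt_iff₀ hc] at hlt
    refine HasDeviations.equilibriaAchieve h0.le h1.le
      (hasDeviations_of_supply hr hρ hHB h0 h1 n k (div_pos hC0 hsn) fun j => ?_)
    refine le_trans ?_ (hk j)
    have e1 : 16 * (m : ℝ) ^ 2 * (B + H) ^ 2 * (r : ℝ) ^ 8 /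
        ((C / √(n : ℝ)) ^ 2 * ρ ^ 2 * (δ * (1 - δ))) = A * n / C ^ 2 := by
      rw [div_pow, Real.sq_sqrt hn'.le, hA]
      field_simp
    have e2 : A * n / C ^ 2 ≤ c * n / 2 := by
      rw [hC2, div_le_iff₀ (by positivity)]
      have : c * n / 2 * (2 * (A + r) / c) = n * (A + r) := by field_simp
      rw [this]
      nlinarith
    rw [e1]
    linarith

end Supply

end UniformPrice

theorem mainTheorem5 {m r : ℕ} (hr : 0 < r) (H B ρ δ : ℝ) (hρ : 0 < ρ) (hHB : H ≤ B)
    (hδ0 : 0 < δ) (hδ1 : δ < 1) :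
    (∀ (n : ℕ) (k : Fin m → ℕ) (ε : ℝ), 0 < ε →
      (∀ j, 16 * (m : ℝ) ^ 2 * (B + H) ^ 2 * (r : ℝ) ^ 8 / (ε ^ 2 * ρ ^ 2 * (δ * (1 - δ))) + r
        ≤ k j) →
      UniformPrice.IsSmooth n r k H B ρ δ (1 - ε) 1 ∧
      (ε < 1 → UniformPrice.robustPoA n r k H B ρ δ ≤ ENNReal.ofReal (1 / (1 - ε))) ∧
      UniformPrice.EquilibriaAchieve n r k H B ρ δ (1 - ε)) ∧
    (r = 1 → ∀ (n : ℕ) (k : Fin m → ℕ) (ε : ℝ), 0 < ε →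
      (∀ j, 36 * (m : ℝ) ^ 2 * (B + H) ^ 2 / (ε ^ 2 * ρ ^ 2 * (δ * (1 - δ))) ≤ k j) →
      UniformPrice.IsSmooth n r k H B ρ δ (1 - ε) 1 ∧
      (ε < 1 → UniformPrice.robustPoA n r k H B ρ δ ≤ ENNReal.ofReal (1 / (1 - ε))) ∧
      UniformPrice.EquilibriaAchieve n r k H B ρ δ (1 - ε)) ∧
    (∀ c : ℝ, 0 < c → ∃ C : ℝ, ∀ n : ℕ, 0 < n → ∀ k : Fin m → ℕ, (∀ j, c * (n : ℝ) ≤ k j) →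
      UniformPrice.EquilibriaAchieve n r k H B ρ δ (1 - C / √(n : ℝ))) := by
  refine ⟨fun n k ε hε hk => ?_, ?_, fun c hc =>
    UniformPrice.equilibriaAchieve_of_linear_supply hr hρ hHB hδ0 hδ1 hc⟩
  · have h := UniformPrice.hasDeviations_of_supply hr hρ hHB hδ0 hδ1 n k hε hk
    have hs := h.isSmooth hδ0.le hδ1.le
    exact ⟨hs, fun hε1 => UniformPrice.robustPoA_le_of_isSmooth (by linarith) hs,
      h.equilibriaAchieve hδ0.le hδ1.le⟩
  · rintro rfl n k ε hε hk
    have h := UniformPrice.hasDeviations_of_supply_unit hρ hHB hδ0 hδ1 n k hε hk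
    have hs := h.isSmooth hδ0.le hδ1.le
    exact ⟨hs, fun hε1 => UniformPrice.robustPoA_le_of_isSmooth (by linarith) hs,
      h.equilibriaAchieve hδ0.le hδ1.le⟩
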